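/- Let $\varepsilon_0,\varepsilon_1\in\{1,-1\}$. A (para)contact metric manifold is a $(2n+1)$-dimensional smooth manifold $M$ ($n\ge 0$) with a smooth $(1,1)$-tensor field $\varphi$, a smooth vector field $\xi$, a smooth $1$-form $\eta$ and a Riemannian or pseudo-Riemannian metric $g$ such that, for all vector fields $X,Y$, $$\varphi^2X=\varepsilon_1(X-\eta(X)\xi),\qquad \eta(\xi)=1,\qquad g(\varphi X,\varphi Y)=-\varepsilon_1\bigl(g(X,Y)-\varepsilon_0\,\eta(X)\eta(Y)\bigr),$$ $$g(X,\varphi Y)=d\eta(X,Y),\qquad\text{where } d\eta(X,Y)=\tfrac12\bigl(X\eta(Y)-Y\eta(X)-\eta([X,Y])\bigr).$$ Let $\nabla$ be the Levi-Civita connection of $g$, $(\nabla_X\varphi)Y=\nabla_X(\varphi Y)-\varphi(\nabla_XY)$, $R(X,Y)=[\nabla_X,\nabla_Y]-\nabla_{[X,Y]}$ the curvature operator, and $[R(X,Y),\varphi]=R(X,Y)\circ\varphi-\varphi\circ R(X,Y)$. **Theorem.** On every (para)contact metric manifold, for all smooth vector fields $X,Y,Z$, $$\begin{aligned} &\bigl([R(Z,\varphi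 X),\varphi]+[R(\varphi Z,X),\varphi]-\varepsilon_1[R(\varphi Z,\varphi X),\varphi]\varphi-[R(Z,X),\varphi]\varphi\bigr)Y\\ &\qquad-\eta(Y)\bigl(\varepsilon_1R(Z,X)\xi+R(\varphi Z,\varphi X)\xi\bigr)\\ &=-2\bigl(\nabla_{(\nabla_Z\varphi)X-(\nabla_X\varphi)Z}\,\varphi\bigr)Y+2\varepsilon_0\varepsilon_1\eta(X)(\nabla_Z\varphi)Y-2\varepsilon_0\varepsilon_1\eta(Z)(\nabla_X\varphi)Y\\ &\quad-2\varepsilon_1\,g\bigl(Y,(\nabla_Z\varphi)X-(\nabla_X\varphi)Z\bigr)\xi+2\varepsilon_0\varepsilon_1\eta(Y)\bigl((\nabla_Z\varphi)X-(\nabla_X\varphi)Z\bigr)\\ &\quad-4\varepsilon_0\,g(\varphi X,\varphi Y)\varphi^2Z+4\varepsilon_0\,g(\varphi Z,\varphi Y)\varphi^2X+4\varepsilon_0\varepsilon_1\,g(Y,\varphi X)\varphi Z-4\varepsilon_0\varepsilon_1\,g(Y,\varphi Z)\varphi X . \end{aligned}$$ -/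

import Mathlib

open Bundle VectorField
open scoped Manifold ContDiff

noncomputable section

namespace ParacontactGeometry

variable {E : Type*} [NormedAddCommGroup E] [NormedSpace ℝ E]
  {H : Type*} [TopologicalSpace H] (I : ModelWithCorners ℝ E H)
  (M : Type*) [TopologicalSpace M] [ChartedSpace H M] [IsManifold I ∞ M]

/-- A smooth pseudo-Riemannian metric on `M` (a Riemannian one is the positive definite case):
a smooth field of nondegenerate symmetric bilinear forms on the tangent spaces. -/
structure PseudoRiemannianMetric where
  /-- The bilinear form on each tangent space. -/
  val : ∀ x : M, TangentSpace I x →L[ℝ] TangentSpace I x →L[ℝ] ℝ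
  symm : ∀ (x : M) (v w : TangentSpace I x), val x v w = val x w v
  nondegenerate : ∀ (x : M) (v : TangentSpace I x), (∀ w, val x v w = 0) → v = 0
  contMDiff : ContMDiff I (I.prod 𝓘(ℝ, E →L[ℝ] E →L[ℝ] ℝ)) ∞
    (fun x ↦ TotalSpace.mk' (E →L[ℝ] E →L[ℝ] ℝ)
      (E := fun x : M ↦ TangentSpace I x →L[ℝ] TangentSpace I x →L[ℝ] Trivial M ℝ x) x (val x))

variable {I M}

/-- A smooth vector field on `M`. -/
def IsSmoothField (X : Π x : M, TangentSpace I x) : Prop :=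
  ContMDiff I I.tangent ∞ (fun x ↦ (⟨x, X x⟩ : TangentBundle I M))

/-- A smooth field of endomorphisms of the tangent spaces, i.e. a smooth `(1,1)`-tensor field. -/
def IsSmoothEndomorphismField (T : ∀ x : M, TangentSpace I x →L[ℝ] TangentSpace I x) : Prop :=
  ContMDiff I (I.prod 𝓘(ℝ, E →L[ℝ] E)) ∞
    (fun x ↦ TotalSpace.mk' (E →L[ℝ] E)
      (E := fun x : M ↦ TangentSpace I x →L[ℝ] TangentSpace I x) x (T x))

/-- A smooth `1`-form. -/
def IsSmoothOneForm (η : ∀ x : M, TangentSpace I x →L[ℝ] ℝ) : Prop :=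
  ContMDiff I (I.prod 𝓘(ℝ, E →L[ℝ] ℝ)) ∞
    (fun x ↦ TotalSpace.mk' (E →L[ℝ] ℝ)
      (E := fun x : M ↦ TangentSpace I x →L[ℝ] Trivial M ℝ x) x (η x))

/-- The exterior derivative of a `1`-form evaluated on two vector fields, with the normalisation
`dη(X, Y) = 1/2 (X η(Y) - Y η(X) - η([X, Y]))` that is usual in contact metric geometry. -/
def extDerivOneForm (η : ∀ x : M, TangentSpace I x →L[ℝ] ℝ)
    (X Y : Π x : M, TangentSpace I x) (x : M) : ℝ :=
  (1 / 2 : ℝ) * (mvfderiv I (fun y ↦ η y (Y y)) x (X x) - mvfderiv I (fun y ↦ η y (X y)) x (Y x)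
    - η x (mlieBracket I X Y x))

namespace PseudoRiemannianMetric

variable (g : PseudoRiemannianMetric I M)

/-- The right-hand side of the Koszul formula for `2 g(∇_X Y, Z)`. -/
def koszul (X Y Z : Π x : M, TangentSpace I x) (x : M) : ℝ :=
  mvfderiv I (fun y ↦ g.val y (Y y) (Z y)) x (X x)
    + mvfderiv I (fun y ↦ g.val y (X y) (Z y)) x (Y x)
    - mvfderiv I (fun y ↦ g.val y (X y) (Y y)) x (Z x)
    + g.val x (mlieBracket I X Y x) (Z x)
    - g.val x (mlieBracket I X Z x) (Y x)
    - g.val x (mlieBracket I Y Z x) (X x)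

lemma mdifferentiableAt_val {Y Z : Π x : M, TangentSpace I x} {x : M}
    (hY : MDiffAt (T% Y) x) (hZ : MDiffAt (T% Z) x) :
    MDiffAt (fun y ↦ g.val y (Y y) (Z y)) x := by
  have h1 := (g.contMDiff.contMDiffAt (x := x)).mdifferentiableAt (by simp)
  have h2 := MDifferentiableAt.clm_bundle_apply₂ (F₁ := E) (F₂ := E) h1 hY hZ
  simp only [mdifferentiableAt_totalSpace] at h2
  exact h2.2

lemma ext_of_val {x : M} {v w : TangentSpace I x}
    (h : ∀ u, g.val x v u = g.val x w u) : v = w := by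
  rw [← sub_eq_zero]
  exact g.nondegenerate x _ fun u ↦ by simp [h u]

variable [CompleteSpace E]

lemma koszul_add_left {X X' Y Z : Π x : M, TangentSpace I x} {x : M}
    (hX : MDiffAt (T% X) x) (hX' : MDiffAt (T% X') x)
    (hY : MDiffAt (T% Y) x) (hZ : MDiffAt (T% Z) x) :
    g.koszul (X + X') Y Z x = g.koszul X Y Z x + g.koszul X' Y Z x := by
  have e1 := mvfderiv_fun_add (g.mdifferentiableAt_val hX hZ) (g.mdifferentiableAt_val hX' hZ)
  have e2 := mvfderiv_fun_add (g.mdifferentiableAt_val hX hY) (g.mdifferentiableAt_val hX' hY)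
  simp only [koszul, Pi.add_apply, map_add, add_apply, e1, e2,
    mlieBracket_add_left hX hX']
  ring

lemma koszul_add_middle {X Y Y' Z : Π x : M, TangentSpace I x} {x : M}
    (hX : MDiffAt (T% X) x) (hY : MDiffAt (T% Y) x)
    (hY' : MDiffAt (T% Y') x) (hZ : MDiffAt (T% Z) x) :
    g.koszul X (Y + Y') Z x = g.koszul X Y Z x + g.koszul X Y' Z x := by
  have e1 := mvfderiv_fun_add (g.mdifferentiableAt_val hY hZ) (g.mdifferentiableAt_val hY' hZ)
  have e2 := mvfderiv_fun_add (g.mdifferentiableAt_val hX hY) (g.mdifferentiableAt_val hX hY')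
  simp only [koszul, Pi.add_apply, map_add, add_apply, e1, e2,
    mlieBracket_add_left hY hY', mlieBracket_add_right hY hY']
  ring

lemma koszul_add_right {X Y Z Z' : Π x : M, TangentSpace I x} {x : M}
    (hX : MDiffAt (T% X) x) (hY : MDiffAt (T% Y) x)
    (hZ : MDiffAt (T% Z) x) (hZ' : MDiffAt (T% Z') x) :
    g.koszul X Y (Z + Z') x = g.koszul X Y Z x + g.koszul X Y Z' x := by
  have e1 := mvfderiv_fun_add (g.mdifferentiableAt_val hY hZ) (g.mdifferentiableAt_val hY hZ')
  have e2 := mvfderiv_fun_add (g.mdifferentiableAt_val hX hZ) (g.mdifferentiableAt_val hX hZ')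
  simp only [koszul, Pi.add_apply, map_add, add_apply, e1, e2,
    mlieBracket_add_right hZ hZ']
  ring

lemma koszul_smul_left {f : M → ℝ} {X Y Z : Π x : M, TangentSpace I x} {x : M}
    (hf : MDiffAt f x) (hX : MDiffAt (T% X) x)
    (hY : MDiffAt (T% Y) x) (hZ : MDiffAt (T% Z) x) :
    g.koszul (f • X) Y Z x = f x * g.koszul X Y Z x := by
  have e1 := mvfderiv_fun_mul hf (g.mdifferentiableAt_val hX hZ)
  have e2 := mvfderiv_fun_mul hf (g.mdifferentiableAt_val hX hY)
  simp only [koszul, Pi.smul_apply', map_smul, smul_apply, smul_eq_mul, e1, e2,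
    mlieBracket_smul_left hf hX, map_add, add_apply, map_smul]
  rw [g.symm x (X x) (Z x), g.symm x (X x) (Y x)]
  ring

lemma koszul_smul_middle {f : M → ℝ} {X Y Z : Π x : M, TangentSpace I x} {x : M}
    (hf : MDiffAt f x) (hX : MDiffAt (T% X) x)
    (hY : MDiffAt (T% Y) x) (hZ : MDiffAt (T% Z) x) :
    g.koszul X (f • Y) Z x
      = f x * g.koszul X Y Z x + 2 * (mvfderiv I f x (X x) * g.val x (Y x) (Z x)) := by
  have e1 := mvfderiv_fun_mul hf (g.mdifferentiableAt_val hY hZ)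
  have e2 := mvfderiv_fun_mul hf (g.mdifferentiableAt_val hX hY)
  simp only [koszul, Pi.smul_apply', map_smul, smul_apply, smul_eq_mul, e1, e2,
    mlieBracket_smul_left hf hY, mlieBracket_smul_right hf hY, map_add, add_apply]
  rw [g.symm x (Y x) (X x)]
  ring

lemma koszul_smul_right {f : M → ℝ} {X Y Z : Π x : M, TangentSpace I x} {x : M}
    (hf : MDiffAt f x) (hX : MDiffAt (T% X) x)
    (hY : MDiffAt (T% Y) x) (hZ : MDiffAt (T% Z) x) :
    g.koszul X Y (f • Z) x = f x * g.koszul X Y Z x := by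
  have e1 := mvfderiv_fun_mul hf (g.mdifferentiableAt_val hY hZ)
  have e2 := mvfderiv_fun_mul hf (g.mdifferentiableAt_val hX hZ)
  simp only [koszul, Pi.smul_apply', map_smul, smul_apply, smul_eq_mul, e1, e2,
    mlieBracket_smul_right hf hZ, map_add, add_apply]
  rw [g.symm x (Z x) (Y x), g.symm x (Z x) (X x)]
  ring

variable [FiniteDimensional ℝ E]

open Classical in
/-- The Levi-Civita connection, `leviCivitaFun Y x v = ∇_v Y`, obtained by solving the Koszul
formula `2 g(∇_X Y, Z) = koszul X Y Z` at the points where `Y` is differentiable. -/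
def leviCivitaFun (Y : Π x : M, TangentSpace I x) (x : M) :
    TangentSpace I x →L[ℝ] TangentSpace I x :=
  if hY : MDiffAt (T% Y) x then
    (1 / 2 : ℝ) • (g.val x).inverse ∘L
      TensorialAt.mkHom₂ (I := I) (F := E) (F' := E) (fun X Z ↦ g.koszul X Y Z x) x
        (fun _ hZ ↦ ⟨fun hf hX ↦ g.koszul_smul_left hf hX hY hZ,
          fun hX hX' ↦ g.koszul_add_left hX hX' hY hZ⟩)
        (fun _ hX ↦ ⟨fun hf hZ ↦ g.koszul_smul_right hf hX hY hZ,
          fun hZ hZ' ↦ g.koszul_add_right hX hY hZ hZ'⟩)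
  else 0

lemma val_inverse (x : M) (α : TangentSpace I x →L[ℝ] ℝ) :
    g.val x ((g.val x).inverse α) = α := by
  have : FiniteDimensional ℝ (TangentSpace I x) := inferInstanceAs (FiniteDimensional ℝ E)
  have : T2Space (TangentSpace I x) := inferInstanceAs (T2Space E)
  have hinj : Function.Injective (g.val x).toLinearMap := by
    rw [injective_iff_map_eq_zero]
    intro v hv
    refine g.nondegenerate x v fun w ↦ ?_
    have : g.val x v = 0 := hv
    simp [this]
  have hdim : Module.finrank ℝ (TangentSpace I x)
      = Module.finrank ℝ (TangentSpace I x →L[ℝ] ℝ) := by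
    rw [← (LinearMap.toContinuousLinearMap
      (𝕜 := ℝ) (E := TangentSpace I x) (F' := ℝ)).finrank_eq]
    exact (Subspace.dual_finrank_eq).symm
  have : FiniteDimensional ℝ (TangentSpace I x →L[ℝ] ℝ) :=
    (LinearMap.toContinuousLinearMap (𝕜 := ℝ) (E := TangentSpace I x) (F' := ℝ)).finiteDimensional
  let e := (LinearEquiv.ofInjectiveOfFinrankEq _ hinj hdim).toContinuousLinearEquiv
  have he : g.val x = (e : TangentSpace I x →L[ℝ] TangentSpace I x →L[ℝ] ℝ) := by
    ext v w
    rfl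
  rw [he, ContinuousLinearMap.inverse_equiv]
  exact e.apply_symm_apply α

lemma koszul_formula {X Y Z : Π x : M, TangentSpace I x} {x : M}
    (hX : MDiffAt (T% X) x) (hY : MDiffAt (T% Y) x) (hZ : MDiffAt (T% Z) x) :
    2 * g.val x (g.leviCivitaFun Y x (X x)) (Z x) = g.koszul X Y Z x := by
  rw [leviCivitaFun, dif_pos hY]
  simp only [smul_apply, ContinuousLinearMap.comp_apply, map_smul, val_inverse, smul_eq_mul]
  rw [TensorialAt.mkHom₂_apply _ _ hX hZ]
  ring

/-- The Levi-Civita connection of a pseudo-Riemannian metric. -/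
def leviCivita : CovariantDerivative I E (TangentSpace I : M → Type _) where
  toFun := g.leviCivitaFun
  isCovariantDerivativeOnUniv :=
    { add := by
        intro Y Y' x hY hY' _
        ext1 v
        refine g.ext_of_val fun u ↦ ?_
        have hv := FiberBundle.mdifferentiableAt_extend I E v
        have hu := FiberBundle.mdifferentiableAt_extend I E u
        have h0 := g.koszul_formula hv (mdifferentiableAt_add_section hY hY') hu
        have h1 := g.koszul_formula hv hY hu
        have h2 := g.koszul_formula hv hY' hu
        rw [g.koszul_add_middle hv hY hY' hu] at h0
        simp only [FiberBundle.extend_apply_self] at h0 h1 h2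
        simp only [add_apply, map_add]
        linarith
      leibniz := by
        intro Y f x hY hf _
        ext1 v
        refine g.ext_of_val fun u ↦ ?_
        have hv := FiberBundle.mdifferentiableAt_extend I E v
        have hu := FiberBundle.mdifferentiableAt_extend I E u
        have h0 := g.koszul_formula hv (hf.smul_section hY) hu
        have h1 := g.koszul_formula hv hY hu
        rw [g.koszul_smul_middle hf hv hY hu] at h0
        simp only [FiberBundle.extend_apply_self] at h0 h1
        simp only [add_apply, map_add, smul_apply, map_smul, smul_eq_mul,
          ContinuousLinearMap.smulRight_apply]
        linear_combination h0 / 2 - f x * h1 / 2 }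

/-- The Levi-Civita connection is torsion-free. -/
lemma leviCivita_torsionFree {X Y : Π x : M, TangentSpace I x} {x : M}
    (hX : MDiffAt (T% X) x) (hY : MDiffAt (T% Y) x) :
    g.leviCivita Y x (X x) - g.leviCivita X x (Y x) = mlieBracket I X Y x := by
  refine g.ext_of_val fun u ↦ ?_
  have hu := FiberBundle.mdifferentiableAt_extend I E u
  have h1 := g.koszul_formula hX hY hu
  have h2 := g.koszul_formula hY hX hu
  simp only [koszul, FiberBundle.extend_apply_self, g.symm _ (Y _) (X _),
    mlieBracket_swap_apply (V := Y) (W := X), map_neg, neg_apply] at h1 h2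
  change g.val x (g.leviCivitaFun Y x (X x) - g.leviCivitaFun X x (Y x)) u = _
  rw [map_sub, sub_apply]
  linarith

/-- The Levi-Civita connection is metric: `X g(Y, Z) = g(∇_X Y, Z) + g(Y, ∇_X Z)`. -/
lemma leviCivita_metric {Y Z : Π x : M, TangentSpace I x} {x : M}
    (v : TangentSpace I x) (hY : MDiffAt (T% Y) x) (hZ : MDiffAt (T% Z) x) :
    mvfderiv I (fun y ↦ g.val y (Y y) (Z y)) x v
      = g.val x (g.leviCivita Y x v) (Z x) + g.val x (Y x) (g.leviCivita Z x v) := by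
  have hv := FiberBundle.mdifferentiableAt_extend I E v
  have h1 := g.koszul_formula hv hY hZ
  have h2 := g.koszul_formula hv hZ hY
  simp only [koszul, FiberBundle.extend_apply_self, g.symm _ (Z _) (Y _),
    mlieBracket_swap_apply (V := Z) (W := Y), map_neg, neg_apply] at h1 h2
  rw [g.symm x (Y x)]
  change _ = g.val x (g.leviCivitaFun Y x v) (Z x) + g.val x (g.leviCivitaFun Z x v) (Y x)
  linarith

/-- The vector field `∇_X Y`. -/
def nabla (X Y : Π x : M, TangentSpace I x) : Π x : M, TangentSpace I x :=
  fun x ↦ g.leviCivita Y x (X x)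

/-- The curvature operator `R(X, Y) = [∇_X, ∇_Y] - ∇_[X, Y]` applied to `Z`. -/
def curvature (X Y Z : Π x : M, TangentSpace I x) : Π x : M, TangentSpace I x :=
  g.nabla X (g.nabla Y Z) - g.nabla Y (g.nabla X Z) - g.nabla (mlieBracket I X Y) Z

end PseudoRiemannianMetric

/-- The vector field `T Y` for a `(1,1)`-tensor field `T` and a vector field `Y`. -/
def applyField (T : ∀ x : M, TangentSpace I x →L[ℝ] TangentSpace I x)
    (Y : Π x : M, TangentSpace I x) : Π x : M, TangentSpace I x :=
  fun x ↦ T x (Y x)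

namespace PseudoRiemannianMetric

variable [CompleteSpace E] [FiniteDimensional ℝ E] (g : PseudoRiemannianMetric I M)

/-- The vector field `(∇_X T) Y = ∇_X (T Y) - T (∇_X Y)` for a `(1,1)`-tensor field `T`. -/
def nablaEndomorphism (T : ∀ x : M, TangentSpace I x →L[ℝ] TangentSpace I x)
    (X Y : Π x : M, TangentSpace I x) : Π x : M, TangentSpace I x :=
  g.nabla X (applyField T Y) - applyField T (g.nabla X Y)

/-- The commutator `[R(X, Y), T] Z = R(X, Y) (T Z) - T (R(X, Y) Z)` for a `(1,1)`-tensor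
field `T`. -/
def curvatureCommutator (T : ∀ x : M, TangentSpace I x →L[ℝ] TangentSpace I x)
    (X Y Z : Π x : M, TangentSpace I x) : Π x : M, TangentSpace I x :=
  g.curvature X Y (applyField T Z) - applyField T (g.curvature X Y Z)

end PseudoRiemannianMetric

variable (I M)

/-- An almost (para)contact metric structure `(φ, ξ, η, g)` with signs `ε₀` and `ε₁`: almost contact
for `ε₁ = -1` and almost paracontact for `ε₁ = 1`. -/
structure AlmostParacontactMetricStructure (ε₀ ε₁ : ℝ) where
  /-- The `(1,1)`-tensor field. -/
  φ : ∀ x : M, TangentSpace I x →L[ℝ] TangentSpace I x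
  /-- The characteristic vector field. -/
  ξ : Π x : M, TangentSpace I x
  /-- The `1`-form. -/
  η : ∀ x : M, TangentSpace I x →L[ℝ] ℝ
  /-- The Riemannian or pseudo-Riemannian metric. -/
  g : PseudoRiemannianMetric I M
  smooth_φ : IsSmoothEndomorphismField φ
  smooth_ξ : IsSmoothField ξ
  smooth_η : IsSmoothOneForm η
  φ_sq : ∀ (x : M) (v : TangentSpace I x), φ x (φ x v) = ε₁ • (v - η x v • ξ x)
  η_ξ : ∀ x : M, η x (ξ x) = 1
  compatible : ∀ (x : M) (v w : TangentSpace I x),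
    g.val x (φ x v) (φ x w) = -ε₁ * (g.val x v w - ε₀ * (η x v * η x w))

variable {I M}

/-- The structure is (para)contact metric if the fundamental form `Φ(X, Y) = g(X, φ Y)` equals
`dη`. -/
def AlmostParacontactMetricStructure.IsParacontactMetric {ε₀ ε₁ : ℝ}
    (S : AlmostParacontactMetricStructure I M ε₀ ε₁) : Prop :=
  ∀ X Y : Π x : M, TangentSpace I x, IsSmoothField X → IsSmoothField Y →
    ∀ x : M, S.g.val x (X x) (S.φ x (Y x)) = extDerivOneForm S.η X Y x

namespace AlmostParacontactMetricStructure

variable {ε₀ ε₁ : ℝ} (S : AlmostParacontactMetricStructure I M ε₀ ε₁)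

/-- The vector field `φ X`. -/
def phi (X : Π x : M, TangentSpace I x) : Π x : M, TangentSpace I x :=
  applyField S.φ X

/-- The function `g(X, Y)`. -/
def metric (X Y : Π x : M, TangentSpace I x) : M → ℝ :=
  fun x ↦ S.g.val x (X x) (Y x)

/-- The function `η(X)`. -/
def eta (X : Π x : M, TangentSpace I x) : M → ℝ :=
  fun x ↦ S.η x (X x)

variable [CompleteSpace E] [FiniteDimensional ℝ E]

/-- The vector field `(∇_X φ) Y`. -/
def nablaPhi (X Y : Π x : M, TangentSpace I x) : Π x : M, TangentSpace I x :=
  S.g.nablaEndomorphism S.φ X Y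

/-- The vector field `R(X, Y) Z`. -/
def curv (X Y Z : Π x : M, TangentSpace I x) : Π x : M, TangentSpace I x :=
  S.g.curvature X Y Z

/-- The vector field `[R(X, Y), φ] Z`. -/
def curvComm (X Y Z : Π x : M, TangentSpace I x) : Π x : M, TangentSpace I x :=
  S.g.curvatureCommutator S.φ X Y Z

end AlmostParacontactMetricStructure

end ParacontactGeometry

end

open ParacontactGeometry

/-! Write N = ∇ξ. At each point the structure and its first covariant derivatives satisfy the
relations collected in `ParacontactOneJet`: they come from differentiating φ², from ∇g = 0, from Φ =
dη and from dΦ = d²η = 0. Linear algebra then gives ∇_ξ φ = 0, the relation Nφ + φN = -2ε₀φ² (`N_φ`)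
and the transfer formula `F_φ_left`, which turns (∇_{φX} φ)Y into (∇_X φ)(φY) up to terms in g, η,
ξ, N and φ.

By the Ricci identities, [R(A,B), φ] and R(A,B)ξ are antisymmetrised second covariant derivatives of
φ and ξ. Modulo first-order terms, the transfer formula differentiated along Z turns (∇²_{Z,φX} φ)Y
into (∇²_{Z,X} φ)φY + ε₁η(Y)∇²_{Z,X} ξ. Differentiated along φZ, with φY for Y, it turns (∇²_{φZ,φX}
φ)φY into (∇²_{φZ,X} φ)φ²Y = ε₁((∇²_{φZ,X} φ)Y - η(Y)(∇²_{φZ,X} φ)ξ). Differentiating (∇φ)ξ = -φN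
and `N_φ` gives (∇²_{φZ,X} φ)ξ ≡ -φ∇²_{φZ,X} ξ ≡ ∇²_{φZ,φX} ξ. Hence all second-order terms on the
left-hand side cancel, the η(Y) bracket absorbing those in ξ, and
`curvature_identity_of_second_order` evaluates the first-order remainder.

Two analytic facts support this. The connection is built pointwise from the Koszul formula, so
smoothness of ∇_X Y must be proved (`isSmoothField_nabla`). The hypotheses concern global smooth
fields, so pointwise identities require extending tangent vectors (`exists_isSmoothField_apply_eq`).
-/

noncomputable section

namespace ParacontactGeometry

/-! ### Linear algebra of the one-jet at a point. -/

/-- The value at a point of a (para)contact metric structure `(φ, ξ, η, g)` together with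
`N v = ∇_v ξ` and `F v w = (∇_v φ) w`, and the first order identities between them. -/
structure ParacontactOneJet (ε₀ ε₁ : ℝ) (V : Type*) [AddCommGroup V] [Module ℝ V] where
  φ : V →ₗ[ℝ] V
  ξ : V
  η : V →ₗ[ℝ] ℝ
  g : V →ₗ[ℝ] V →ₗ[ℝ] ℝ
  N : V →ₗ[ℝ] V
  F : V →ₗ[ℝ] V →ₗ[ℝ] V
  ε₀_eq : ε₀ = 1 ∨ ε₀ = -1
  ε₁_eq : ε₁ = 1 ∨ ε₁ = -1
  g_symm : ∀ v w, g v w = g w v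
  nondegenerate : ∀ v, (∀ w, g v w = 0) → v = 0
  φ_sq : ∀ v, φ (φ v) = ε₁ • (v - η v • ξ)
  η_ξ : η ξ = 1
  φ_ξ : φ ξ = 0
  η_φ : ∀ v, η (φ v) = 0
  g_ξ : ∀ v, g v ξ = ε₀ * η v
  g_φ : ∀ v w, g (φ v) w = - g v (φ w)
  η_N : ∀ v, η (N v) = 0
  N_skew : ∀ v w, g (N v) w - g (N w) v = 2 * ε₀ * g v (φ w)
  F_skew : ∀ v w u, g (F v w) u = - g w (F v u)
  F_φ : ∀ v w, F v (φ w) = - φ (F v w) - (ε₁ * ε₀ * g (N v) w) • ξ - (ε₁ * η w) • N v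
  F_cyclic : ∀ v w u, g (F v w) u + g (F w u) v + g (F u v) w = 0

namespace ParacontactOneJet

variable {ε₀ ε₁ : ℝ} {V : Type*} [AddCommGroup V] [Module ℝ V] (J : ParacontactOneJet ε₀ ε₁ V)

lemma ext_of_g {v w : V} (h : ∀ u, J.g v u = J.g w u) : v = w := by
  rw [← sub_eq_zero]
  exact J.nondegenerate _ fun u ↦ by simp [h u]

lemma g_ξ_left (v : V) : J.g J.ξ v = ε₀ * J.η v := by
  rw [J.g_symm, J.g_ξ]

lemma ε₀_mul_self (J : ParacontactOneJet ε₀ ε₁ V) : ε₀ * ε₀ = 1 := by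
  rcases J.ε₀_eq with h | h <;> simp [h]

lemma η_eq (v : V) : J.η v = ε₀ * J.g v J.ξ := by
  rw [J.g_ξ, ← mul_assoc, J.ε₀_mul_self, one_mul]

/-- This is φξ = 0 differentiated. Here `F_φ` at ξ gives φ(F v ξ) = -ε₁ N v; a second φ recovers F v
ξ, whose η-component vanishes by skewness. -/
lemma F_ξ_right (v : V) : J.F v J.ξ = - J.φ (J.N v) := by
  have h1 : J.φ (J.F v J.ξ) = -(ε₁ • J.N v) := by
    have h := J.F_φ v J.ξ
    rw [J.φ_ξ, J.g_ξ, J.η_N, J.η_ξ] at h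
    simp only [map_zero, mul_zero, zero_smul, mul_one, sub_zero] at h
    linear_combination (norm := module) h
  have h2 : J.η (J.F v J.ξ) = 0 := by
    have := J.F_skew v J.ξ J.ξ
    rw [J.g_symm J.ξ] at this
    rw [J.η_eq]
    linear_combination ε₀ / 2 * this
  have h3 := J.φ_sq (J.F v J.ξ)
  rw [h1, h2] at h3
  rcases J.ε₁_eq with rfl | rfl <;> simp at h3 <;> simp [h3]

lemma η_F (v w : V) : J.η (J.F v w) = ε₀ * J.g w (J.φ (J.N v)) := by
  rw [J.η_eq, J.F_skew, J.F_ξ_right]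
  simp

lemma N_ξ : J.N J.ξ = 0 := by
  refine J.nondegenerate _ fun w ↦ ?_
  have := J.N_skew J.ξ w
  rw [J.g_ξ, J.η_N, J.g_ξ_left, J.η_φ] at this
  linarith

lemma F_ξ_left_apply_eq (v w : V) :
    J.g (J.F J.ξ v) w = J.g (J.N v) (J.φ w) - J.g (J.N w) (J.φ v) := by
  have h := J.F_cyclic J.ξ v w
  rw [J.F_skew v w, J.F_ξ_right, J.F_ξ_right, J.g_symm w] at h
  simp only [map_neg, LinearMap.neg_apply, J.g_φ] at h
  linarith

/-- Let f(v, w) = g(F ξ v, w). By `F_φ` and N ξ = 0, f(φv, φw) = ε₁ f(v, w). Rewriting f through N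
by `F_ξ_left_apply_eq` and using `N_skew` gives f(φv, φw) = -ε₁ f(v, w), so f = 0. -/
lemma F_ξ_left (v : V) : J.F J.ξ v = 0 := by
  refine J.nondegenerate _ fun w ↦ ?_
  have h1 := J.F_ξ_left_apply_eq (J.φ v) (J.φ w)
  have h2 := J.F_ξ_left_apply_eq v w
  rw [J.F_φ, J.N_ξ] at h1
  have a1 := J.N_skew (J.φ v) w
  have a2 := J.N_skew (J.φ w) v
  simp only [map_sub, map_neg, map_smul, map_zero, LinearMap.sub_apply, LinearMap.neg_apply,
    LinearMap.smul_apply, smul_eq_mul, J.g_φ, J.φ_sq, J.g_ξ, J.η_N, J.η_F, J.N_ξ,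
    LinearMap.zero_apply, smul_zero] at h1 a1 a2
  have h3 := J.g_symm v w
  rcases J.ε₀_eq with rfl | rfl <;> rcases J.ε₁_eq with rfl | rfl <;> linarith

lemma g_N_φ_symm (v w : V) : J.g (J.N v) (J.φ w) = J.g (J.N w) (J.φ v) := by
  have h := J.F_ξ_left_apply_eq v w
  rw [J.F_ξ_left] at h
  simp only [map_zero, LinearMap.zero_apply] at h
  linarith

lemma g_φ_N (v w : V) : J.g v (J.φ (J.N w)) = - J.g (J.N w) (J.φ v) := by
  rw [J.g_symm, J.g_φ]

/-- `g_N_φ_symm` says that φN is g-symmetric, and `N_skew` says that the skew part of N is a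
multiple of φ; together they determine Nφ + φN, which is -2ε₀φ². -/
lemma N_φ (v : V) :
    J.N (J.φ v) = - J.φ (J.N v) - (2 * ε₀ * ε₁) • (v - J.η v • J.ξ) := by
  refine J.ext_of_g fun w ↦ ?_
  have h1 := J.N_skew (J.φ v) w
  have h2 := J.g_N_φ_symm v w
  have h3 : J.g (J.φ (J.φ v)) w = ε₁ * J.g (v - J.η v • J.ξ) w := by
    rw [J.φ_sq, map_smul, LinearMap.smul_apply, smul_eq_mul]
  rw [map_sub, map_neg, LinearMap.sub_apply, LinearMap.neg_apply, J.g_φ, map_smul,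
    LinearMap.smul_apply, smul_eq_mul]
  rw [J.g_φ] at h3
  linear_combination h1 - h2 - 2 * ε₀ * h3

/-- Modulo terms in N, η and g, F v is skew for g and anticommutes with φ, so φ can be moved between
the last two slots of g(F v w, u). In c2 + c3 - c4 the terms differentiated along φy and φz cancel,
leaving 2 g(F (φx) (φy), z) and undifferentiated-φ terms that c1 reduces to -2ε₁ g(F x y, z). -/
lemma F_φ_φ_apply (x y z : V) :
    J.g (J.F (J.φ x) (J.φ y)) z = ε₁ * J.g (J.F x y) z + ε₁ * J.η y * J.g (J.φ (J.N x)) z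
      + 2 * ε₀ * (J.g x y - ε₀ * J.η x * J.η y) * J.η z := by
  have c1 := J.F_cyclic x y z
  have c2 := J.F_cyclic (J.φ x) (J.φ y) z
  have c3 := J.F_cyclic (J.φ x) y (J.φ z)
  have c4 := J.F_cyclic x (J.φ y) (J.φ z)
  simp only [J.F_φ, J.N_φ, map_sub, map_neg, map_smul, LinearMap.sub_apply,
    LinearMap.neg_apply, LinearMap.smul_apply, smul_eq_mul, J.g_φ, J.φ_sq, J.g_ξ, J.g_ξ_left,
    J.η_F, J.η_φ, mul_zero, sub_zero, neg_neg, J.g_φ_N, J.g_N_φ_symm y x, J.g_N_φ_symm z x,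
    J.g_N_φ_symm z y, J.g_symm y x, J.g_symm z x, J.g_symm z y] at c1 c2 c3 c4 ⊢
  rcases J.ε₀_eq with rfl | rfl <;> rcases J.ε₁_eq with rfl | rfl <;> linarith

lemma F_φ_φ (x y : V) :
    J.F (J.φ x) (J.φ y) = ε₁ • J.F x y + (ε₁ * J.η y) • J.φ (J.N x)
      + (2 * (J.g x y - ε₀ * J.η x * J.η y)) • J.ξ := by
  refine J.ext_of_g fun z ↦ ?_
  rw [F_φ_φ_apply]
  simp only [map_add, map_smul, LinearMap.add_apply, LinearMap.smul_apply, smul_eq_mul,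
    J.g_ξ_left]
  ring

/-- Substitute φy for y in `F_φ_φ`, expand φ²y and multiply by ε₁. This is the form that is
differentiated later. -/
lemma F_φ_left (x y : V) :
    J.F (J.φ x) y = J.F x (J.φ y) - (2 * ε₁ * J.g (J.φ x) y) • J.ξ
      + (ε₁ * J.η y) • (J.N x + (2 * ε₀) • J.φ x) := by
  have h := J.F_φ_φ x (J.φ y)
  simp only [map_sub, map_neg, map_smul, J.F_φ, J.N_φ, J.F_ξ_right, J.φ_sq, J.g_φ, J.η_N, J.η_φ,
    J.φ_ξ] at h ⊢
  have h' := congrArg (ε₁ • ·) h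
  rcases J.ε₀_eq with rfl | rfl <;> rcases J.ε₁_eq with rfl | rfl <;>
  linear_combination (norm := module) h'

set_option maxHeartbeats 800000 in
/-- The algebraic part of the curvature identity: `K₁, …, K₆` and `K₁', …, K₆'` stand for the
values `(∇²_{Z,φX} φ) Y`, `(∇²_{φZ,X} φ) Y`, `(∇²_{φZ,φX} φ) φY`, `(∇²_{Z,X} φ) φY`,
`(∇²_{φZ,X} φ) φ²Y`, `(∇²_{φZ,X} φ) ξ` and those with `X` and `Z` exchanged, `L₁, L₂, L₃` and
`L₁', L₂', L₃'` for `∇²_{Z,X} ξ`, `∇²_{φZ,X} ξ`, `∇²_{φZ,φX} ξ` and those with `X` and `Z`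
exchanged. -/
lemma curvature_identity_of_second_order (X Y Z : V)
    (K₁ K₁' K₂ K₂' K₃ K₃' K₄ K₄' K₅ K₅' K₆ K₆' L₁ L₁' L₂ L₂' L₃ L₃' : V)
    (a₁ : K₁ + J.F (J.F Z X) Y = K₄ + J.F X (J.F Z Y)
      - (2 * ε₁ * J.g (J.F Z X) Y) • J.ξ - (2 * ε₁ * J.g (J.φ X) Y) • J.N Z
      + (ε₁ * ε₀ * J.g (J.N Z) Y) • (J.N X + (2 * ε₀) • J.φ X)
      + (ε₁ * J.η Y) • (L₁ + (2 * ε₀) • J.F Z X))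
    (a₁' : K₁' + J.F (J.F X Z) Y = K₄' + J.F Z (J.F X Y)
      - (2 * ε₁ * J.g (J.F X Z) Y) • J.ξ - (2 * ε₁ * J.g (J.φ Z) Y) • J.N X
      + (ε₁ * ε₀ * J.g (J.N X) Y) • (J.N Z + (2 * ε₀) • J.φ Z)
      + (ε₁ * J.η Y) • (L₁' + (2 * ε₀) • J.F X Z))
    (a₂ : K₃ + J.F (J.F (J.φ Z) X) (J.φ Y) = K₅ + J.F X (J.F (J.φ Z) (J.φ Y))
      - (2 * ε₁ * J.g (J.F (J.φ Z) X) (J.φ Y)) • J.ξ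
      - (2 * ε₁ * J.g (J.φ X) (J.φ Y)) • J.N (J.φ Z)
      + (ε₁ * ε₀ * J.g (J.N (J.φ Z)) (J.φ Y)) • (J.N X + (2 * ε₀) • J.φ X)
      + (ε₁ * J.η (J.φ Y)) • (L₂ + (2 * ε₀) • J.F (J.φ Z) X))
    (a₂' : K₃' + J.F (J.F (J.φ X) Z) (J.φ Y) = K₅' + J.F Z (J.F (J.φ X) (J.φ Y))
      - (2 * ε₁ * J.g (J.F (J.φ X) Z) (J.φ Y)) • J.ξ
      - (2 * ε₁ * J.g (J.φ Z) (J.φ Y)) • J.N (J.φ X)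
      + (ε₁ * ε₀ * J.g (J.N (J.φ X)) (J.φ Y)) • (J.N Z + (2 * ε₀) • J.φ Z)
      + (ε₁ * J.η (J.φ Y)) • (L₂' + (2 * ε₀) • J.F (J.φ X) Z))
    (b : K₅ = ε₁ • (K₂ - J.η Y • K₆)) (b' : K₅' = ε₁ • (K₂' - J.η Y • K₆'))
    (c : K₆ = - J.F X (J.N (J.φ Z)) - J.F (J.φ Z) (J.N X) - J.φ L₂)
    (c' : K₆' = - J.F Z (J.N (J.φ X)) - J.F (J.φ X) (J.N Z) - J.φ L₂')
    (d : J.F (J.φ Z) (J.N X) + J.φ L₂ + L₃ + J.N (J.F (J.φ Z) X)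
      = -(2 * ε₀) • (J.F (J.φ Z) (J.φ X) + J.φ (J.F (J.φ Z) X)))
    (d' : J.F (J.φ X) (J.N Z) + J.φ L₂' + L₃' + J.N (J.F (J.φ X) Z)
      = -(2 * ε₀) • (J.F (J.φ X) (J.φ Z) + J.φ (J.F (J.φ X) Z))) :
    (K₁ - K₂') + (K₂ - K₁') - ε₁ • (K₃ - K₃') - (K₄ - K₄')
      - J.η Y • (ε₁ • (L₁ - L₁') + (L₃ - L₃'))
    = -(2 : ℝ) • J.F (J.F Z X - J.F X Z) Y
        + (2 * ε₀ * ε₁ * J.η X) • J.F Z Y - (2 * ε₀ * ε₁ * J.η Z) • J.F X Y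
        - (2 * ε₁ * J.g Y (J.F Z X - J.F X Z)) • J.ξ
        + (2 * ε₀ * ε₁ * J.η Y) • (J.F Z X - J.F X Z)
        - (4 * ε₀ * J.g (J.φ X) (J.φ Y)) • J.φ (J.φ Z)
        + (4 * ε₀ * J.g (J.φ Z) (J.φ Y)) • J.φ (J.φ X)
        + (4 * ε₀ * ε₁ * J.g Y (J.φ X)) • J.φ Z - (4 * ε₀ * ε₁ * J.g Y (J.φ Z)) • J.φ X := by
  simp only [J.F_φ_left, map_add, map_sub, map_neg, map_smul, map_zero, LinearMap.add_apply,
    LinearMap.sub_apply, LinearMap.neg_apply, LinearMap.smul_apply, LinearMap.zero_apply,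
    smul_eq_mul, J.F_φ, J.N_φ, J.F_ξ_left, J.F_ξ_right, J.φ_sq, J.g_φ, J.g_ξ, J.g_ξ_left,
    J.η_N, J.η_F, J.N_ξ, J.η_φ, J.φ_ξ, J.g_φ_N, J.g_N_φ_symm Z X, J.g_N_φ_symm Z Y,
    J.g_symm Z X, J.g_symm Z Y] at *
  have e1 := J.g_symm Y (J.F Z X)
  have e2 := J.g_symm Y (J.F X Z)
  have e3 : J.g Y (J.φ X) = -J.g X (J.φ Y) := by rw [J.g_symm, J.g_φ]
  have e4 : J.g Y (J.φ Z) = -J.g Z (J.φ Y) := by rw [J.g_symm, J.g_φ]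
  subst b b' c c'
  -- In every sign case the combination is a₁ - a₁' - ε₁(a₂ - a₂') - η(Y)(d - d'). The coefficients
  -- agree only after using the symmetry relations e1–e4, hence `linarith` on each scalar.
  rcases J.ε₀_eq with rfl | rfl <;> rcases J.ε₁_eq with rfl | rfl
  · linear_combination (norm := skip) a₁ - a₁' - a₂ + a₂' - J.η Y • (d - d')
    match_scalars <;> linarith
  · linear_combination (norm := skip) a₁ - a₁' + a₂ - a₂' - J.η Y • (d - d')
    match_scalars <;> linarith
  · linear_combination (norm := skip) a₁ - a₁' - a₂ + a₂' - J.η Y • (d - d')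
    match_scalars <;> linarith
  · linear_combination (norm := skip) a₁ - a₁' + a₂ - a₂' - J.η Y • (d - d')
    match_scalars <;> linarith

end ParacontactOneJet

/-! ### Smoothness of covariant derivatives. -/

open Topology

variable {E : Type*} [NormedAddCommGroup E] [NormedSpace ℝ E]
  {H : Type*} [TopologicalSpace H] {I : ModelWithCorners ℝ E H}
  {M : Type*} [TopologicalSpace M] [ChartedSpace H M]

lemma contMDiffAt_det {ι : Type*} [Fintype ι] [DecidableEq ι] {A : M → Matrix ι ι ℝ} {x : M}
    (hA : ∀ i j, CMDiffAt ∞ (fun y ↦ A y i j) x) : CMDiffAt ∞ (fun y ↦ (A y).det) x := by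
  simp only [Matrix.det_apply']
  refine contMDiffAt_finsetSum fun σ _ ↦ ?_
  exact contMDiffAt_const.mul (contMDiffAt_finsetProd fun i _ ↦ hA _ _)

/-- Cramer's rule: near x, c is the adjugate of A applied to A c, divided by det A, and these are
polynomial in smooth entries. -/
lemma contMDiffAt_of_mulVec {ι : Type*} [Fintype ι] [DecidableEq ι] {A : M → Matrix ι ι ℝ}
    {c : M → ι → ℝ} {x : M} (hA : ∀ i j, CMDiffAt ∞ (fun y ↦ A y i j) x)
    (hdet : (A x).det ≠ 0) (hc : ∀ i, CMDiffAt ∞ (fun y ↦ (A y).mulVec (c y) i) x) (i : ι) :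
    CMDiffAt ∞ (fun y ↦ c y i) x := by
  have hadj : ∀ i j, CMDiffAt ∞ (fun y ↦ (A y).adjugate i j) x := by
    intro i j
    simp only [Matrix.adjugate_apply]
    refine contMDiffAt_det fun k l ↦ ?_
    by_cases hk : k = j
    · subst hk
      simpa using contMDiffAt_const
    · simpa [Matrix.updateRow_ne hk] using hA k l
  have h1 : CMDiffAt ∞ (fun y ↦ (A y).det⁻¹ *
      ∑ j, (A y).adjugate i j * (A y).mulVec (c y) j) x :=
    ((contMDiffAt_det hA).inv₀ hdet).mul
      (contMDiffAt_finsetSum fun j _ ↦ (hadj i j).mul (hc j))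
  refine h1.congr_of_eventuallyEq ?_
  filter_upwards [(contMDiffAt_det hA).continuousAt.eventually_ne hdet] with y hy
  have h2 : (A y).adjugate.mulVec ((A y).mulVec (c y)) = (A y).det • c y := by
    rw [Matrix.mulVec_mulVec, Matrix.adjugate_mul, Matrix.smul_mulVec, Matrix.one_mulVec]
  have h3 := congrFun h2 i
  simp only [Matrix.mulVec, dotProduct, Pi.smul_apply, smul_eq_mul] at h3 ⊢
  rw [h3]
  field_simp

variable [IsManifold I ∞ M]

lemma minSmoothness_ofNat_le_infty (n : ℕ) [n.AtLeastTwo] :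
    minSmoothness ℝ (OfNat.ofNat n : WithTop ℕ∞) ≤ ∞ := by
  rw [minSmoothness_of_isRCLikeNormedField]
  exact WithTop.coe_le_coe.mpr (le_top : (OfNat.ofNat n : ℕ∞) ≤ ⊤)

/-- The derivative of a smooth function along a smooth vector field is smooth. -/
lemma contMDiffAt_mvfderiv_apply {f : M → ℝ} {X : Π x : M, TangentSpace I x} {x : M}
    (hf : CMDiffAt ∞ f x) (hX : CMDiffAt ∞ (T% X) x) :
    CMDiffAt ∞ (fun y ↦ mvfderiv I f y (X y)) x := by
  have h := ContMDiffAt.clm_apply_of_inCoordinates (hf.mfderiv_const (m := ∞) (by simp)) hX hf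
  exact (contMDiff_snd_tangentBundle_modelSpace ℝ 𝓘(ℝ, ℝ)).contMDiffAt.comp x h

lemma contMDiffAt_mlieBracket [CompleteSpace E] {X Y : Π x : M, TangentSpace I x} {x : M}
    (hX : CMDiffAt ∞ (T% X) x) (hY : CMDiffAt ∞ (T% Y) x) :
    CMDiffAt ∞ (T% (mlieBracket I X Y)) x := by
  have : IsManifold I ((∞ : WithTop ℕ∞) + 1) M := inferInstanceAs (IsManifold I ∞ M)
  have : IsManifold I (minSmoothness ℝ 2) M :=
    IsManifold.of_le (n := ∞) (minSmoothness_ofNat_le_infty _)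
  exact ContMDiffAt.mlieBracket_vectorField (m := ⊤) (n := ⊤) hX hY (by simp)

lemma PseudoRiemannianMetric.contMDiffAt_val (g : PseudoRiemannianMetric I M)
    {X Y : Π x : M, TangentSpace I x} {x : M}
    (hX : CMDiffAt ∞ (T% X) x) (hY : CMDiffAt ∞ (T% Y) x) :
    CMDiffAt ∞ (fun y ↦ g.val y (X y) (Y y)) x := by
  have h := ContMDiffAt.clm_bundle_apply₂ (F₁ := E) (F₂ := E) g.contMDiff.contMDiffAt hX hY
  simp only [contMDiffAt_totalSpace] at h
  exact h.2

lemma PseudoRiemannianMetric.contMDiffAt_koszul [CompleteSpace E] (g : PseudoRiemannianMetric I M)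
    {X Y Z : Π x : M, TangentSpace I x} {x : M} (hX : CMDiffAt ∞ (T% X) x)
    (hY : CMDiffAt ∞ (T% Y) x) (hZ : CMDiffAt ∞ (T% Z) x) :
    CMDiffAt ∞ (g.koszul X Y Z) x :=
  (((((contMDiffAt_mvfderiv_apply (g.contMDiffAt_val hY hZ) hX).add
    (contMDiffAt_mvfderiv_apply (g.contMDiffAt_val hX hZ) hY)).sub
    (contMDiffAt_mvfderiv_apply (g.contMDiffAt_val hX hY) hZ)).add
    (g.contMDiffAt_val (contMDiffAt_mlieBracket hX hY) hZ)).sub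
    (g.contMDiffAt_val (contMDiffAt_mlieBracket hX hZ) hY)).sub
    (g.contMDiffAt_val (contMDiffAt_mlieBracket hY hZ) hX)

/-- A vector field is smooth if its inner products with the fields of a local frame are. -/
lemma PseudoRiemannianMetric.contMDiffAt_of_val [FiniteDimensional ℝ E]
    (g : PseudoRiemannianMetric I M) {W : Π x : M, TangentSpace I x} {x : M}
    (h : ∀ Z : Π x : M, TangentSpace I x, (∀ᶠ y in 𝓝 x, CMDiffAt ∞ (T% Z) y) →
      CMDiffAt ∞ (fun y ↦ g.val y (W y) (Z y)) x) :
    CMDiffAt ∞ (T% W) x := by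
  classical
  let e := trivializationAt E (TangentSpace I : M → Type _) x
  let b := Module.finBasis ℝ E
  have hx : x ∈ e.baseSet := FiberBundle.mem_baseSet_trivializationAt' x
  have hs (i) : ∀ᶠ y in 𝓝 x, CMDiffAt ∞ (T% (e.localFrame b i)) y := by
    filter_upwards [e.open_baseSet.mem_nhds hx] with y hy
    exact contMDiffAt_localFrame_of_mem ∞ e b i hy
  rw [contMDiffAt_iff_localFrameCoeff (e := e) b hx]
  -- The Gram matrix of the frame sends the frame coefficients of W to the products g(W, eᵢ).
  -- Nondegeneracy of g makes it invertible at x.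
  let A : M → Matrix _ _ ℝ := fun y ↦
    Matrix.of fun i j ↦ g.val y (e.localFrame b j y) (e.localFrame b i y)
  refine contMDiffAt_of_mulVec (A := A) (c := fun y i ↦ e.localFrameCoeff I b i y (W y))
    (fun i j ↦ g.contMDiffAt_val (hs j).self_of_nhds (hs i).self_of_nhds) ?_ ?_
  · intro hdet
    obtain ⟨v, hv, hv0⟩ := Matrix.exists_mulVec_eq_zero_iff.mpr hdet
    have hsum : ∑ j, v j • e.localFrame b j x = 0 := by
      refine g.nondegenerate x _ fun w ↦ ?_
      have hw : ∀ i, g.val x (∑ j, v j • e.localFrame b j x) (e.localFrame b i x) = 0 := by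
        intro i
        have := congrFun hv0 i
        simp only [A, Matrix.mulVec, dotProduct, Matrix.of_apply, Pi.zero_apply] at this
        simp only [map_sum, map_smul, sum_apply, smul_apply, smul_eq_mul]
        rw [← this]
        exact Finset.sum_congr rfl fun j _ ↦ mul_comm _ _
      have hw' : w = ∑ i, (e.basisAt b hx).repr w i • e.localFrame b i x := by
        simp [hx, (e.basisAt b hx).sum_repr]
      rw [hw']
      generalize ∑ j, v j • e.localFrame b j x = u at hw ⊢
      simp only [map_sum, map_smul, hw, smul_zero, Finset.sum_const_zero]
    refine hv (funext fun j ↦ ?_)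
    have := Fintype.linearIndependent_iff.mp (e.basisAt b hx).linearIndependent v
    simp only [hx, Trivialization.localFrame_apply_of_mem_baseSet] at hsum
    exact this hsum j
  · intro i
    refine (h _ (hs i)).congr_of_eventuallyEq ?_
    filter_upwards [e.eventually_eq_localFrame_sum_coeff_smul (I := I) b hx (s := W)] with y hy
    simp only [A, Matrix.mulVec, dotProduct, Matrix.of_apply]
    conv_rhs => rw [hy]
    simp only [map_sum, map_smul, sum_apply, smul_apply, smul_eq_mul]
    exact Finset.sum_congr rfl fun j _ ↦ mul_comm _ _

/-- The covariant derivative of a smooth vector field along a smooth vector field is smooth. -/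
lemma PseudoRiemannianMetric.isSmoothField_nabla [CompleteSpace E] [FiniteDimensional ℝ E]
    (g : PseudoRiemannianMetric I M) {X Y : Π x : M, TangentSpace I x}
    (hX : IsSmoothField X) (hY : IsSmoothField Y) : IsSmoothField (g.nabla X Y) := by
  intro x
  refine g.contMDiffAt_of_val fun Z hZ ↦ ?_
  have h := (contMDiffAt_const (c := (1 / 2 : ℝ))).mul
    (g.contMDiffAt_koszul (hX x) (hY x) hZ.self_of_nhds)
  refine h.congr_of_eventuallyEq ?_
  -- The Koszul formula is needed at all points near x, which is why Z is assumed smooth in a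
  -- neighbourhood and not just at x.
  filter_upwards [hZ] with y hy
  have := g.koszul_formula ((hX y).mdifferentiableAt (by simp)) ((hY y).mdifferentiableAt (by simp))
    (hy.mdifferentiableAt (by simp))
  change g.val y (g.leviCivitaFun Y y (X y)) (Z y) = (1 / 2 : ℝ) * g.koszul X Y Z y
  linarith

/-! ### Global smooth fields and the Lie bracket as a commutator. -/

/-- Every tangent vector is the value of a smooth vector field. -/
lemma exists_isSmoothField_apply_eq [FiniteDimensional ℝ E] [SigmaCompactSpace M] [T2Space M]
    {x : M} (v : TangentSpace I x) : ∃ X : Π x : M, TangentSpace I x, IsSmoothField X ∧ X x = v := by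
  classical
  -- The constraint is vacuous away from x and prescribes the value v at x, so it is convex and
  -- survives gluing by a partition of unity. Local solutions are an extension of v near x and the
  -- zero field elsewhere.
  have hconv (y : M) : Convex ℝ {w : TangentSpace I y | y = x → FiberBundle.extend E v y = w} := by
    by_cases h : y = x
    · simp [h]
    · simpa [h] using convex_univ
  have hloc (y : M) : ∃ U ∈ 𝓝 y, ∃ s : Π z : M, TangentSpace I z, CMDiff[U] ∞ (T% s) ∧
      ∀ z ∈ U, s z ∈ {w : TangentSpace I z | z = x → FiberBundle.extend E v z = w} := by
    by_cases h : y = x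
    · subst h
      obtain ⟨U, hU, h⟩ := FiberBundle.exists_contMDiffOn_extend (k := ∞) I E v
      exact ⟨U, hU, _, h, fun z _ _ ↦ rfl⟩
    · refine ⟨{x}ᶜ, isOpen_compl_singleton.mem_nhds h, 0, ?_, fun z hz hzx ↦ absurd hzx hz⟩
      exact (contMDiff_zeroSection ℝ _).contMDiffOn
  obtain ⟨s, hs⟩ := exists_contMDiffSection_forall_mem_convex_of_local I (n := ⊤)
    (F_fiber := E) (TangentSpace I : M → Type _) _ hconv hloc
  exact ⟨s, s.contMDiff, by simpa using (hs x rfl).symm⟩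

lemma IsSmoothField.mdifferentiableAt {X : Π x : M, TangentSpace I x} (hX : IsSmoothField X)
    (x : M) : MDiffAt (T% X) x :=
  (hX x).mdifferentiableAt (by simp)

lemma isSmoothField_mlieBracket [CompleteSpace E] {X Y : Π x : M, TangentSpace I x}
    (hX : IsSmoothField X) (hY : IsSmoothField Y) : IsSmoothField (mlieBracket I X Y) :=
  fun x ↦ contMDiffAt_mlieBracket (hX x) (hY x)

/-- `[X, Y] f = X (Y f) - Y (X f)`. -/
lemma mvfderiv_mlieBracket [CompleteSpace E] [FiniteDimensional ℝ E] [SigmaCompactSpace M]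
    [T2Space M] {f : M → ℝ} {X Y : Π x : M, TangentSpace I x} (hf : CMDiff ∞ f)
    (hX : IsSmoothField X) (hY : IsSmoothField Y) (x : M) :
    mvfderiv I f x (mlieBracket I X Y x) =
      mvfderiv I (fun y ↦ mvfderiv I f y (Y y)) x (X x)
        - mvfderiv I (fun y ↦ mvfderiv I f y (X y)) x (Y x) := by
  have : IsManifold I (minSmoothness ℝ 2) M :=
    IsManifold.of_le (n := ∞) (minSmoothness_ofNat_le_infty _)
  have : IsManifold I (minSmoothness ℝ 3) M :=
    IsManifold.of_le (n := ∞) (minSmoothness_ofNat_le_infty _)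
  by_cases hv : ∃ v : TangentSpace I x, v ≠ 0
  swap
  · push Not at hv
    simp [hv (X x), hv (Y x), hv (mlieBracket I X Y x)]
  obtain ⟨v, hv⟩ := hv
  obtain ⟨Z, hZ, rfl⟩ := exists_isSmoothField_apply_eq v
  have hfd (y : M) : MDiffAt f y := (hf y).mdifferentiableAt (by simp)
  have hXf : CMDiff ∞ (fun y ↦ mvfderiv I f y (X y)) :=
    fun y ↦ contMDiffAt_mvfderiv_apply (hf y) (hX y)
  have hYf : CMDiff ∞ (fun y ↦ mvfderiv I f y (Y y)) :=
    fun y ↦ contMDiffAt_mvfderiv_apply (hf y) (hY y)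
  have hfZ : IsSmoothField (f • Z) := hf.smul_section hZ
  have expand (W : Π x : M, TangentSpace I x) : mlieBracket I W (f • Z) =
      (fun y ↦ mvfderiv I f y (W y)) • Z + f • mlieBracket I W Z :=
    funext fun y ↦ mlieBracket_smul_right (hfd y) (hZ.mdifferentiableAt y)
  have two : minSmoothness ℝ 2 ≤ ∞ := minSmoothness_ofNat_le_infty 2
  -- The Jacobi identity for X, Y, fZ is compared with f times the one for X, Y, Z. The mixed terms
  -- (Xf)[Y,Z] and (Yf)[X,Z] cancel, leaving (X(Yf) - Y(Xf) - [X,Y]f) Z = 0, where Z is nonzero at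
  -- x.
  have jac := leibniz_identity_mlieBracket_apply (I := I) ((hX x).of_le two) ((hY x).of_le two)
    ((hfZ x).of_le two)
  have jac' := leibniz_identity_mlieBracket_apply (I := I) ((hX x).of_le two) ((hY x).of_le two)
    ((hZ x).of_le two)
  have hYZ := isSmoothField_mlieBracket hY hZ
  have hXZ := isSmoothField_mlieBracket hX hZ
  rw [expand, expand, expand,
    mlieBracket_add_right ((hYf.smul_section hZ).mdifferentiable (by simp) x)
      ((hf.smul_section hYZ).mdifferentiable (by simp) x),
    mlieBracket_add_right ((hXf.smul_section hZ).mdifferentiable (by simp) x)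
      ((hf.smul_section hXZ).mdifferentiable (by simp) x),
    mlieBracket_smul_right ((hYf x).mdifferentiableAt (by simp)) (hZ.mdifferentiableAt x),
    mlieBracket_smul_right ((hXf x).mdifferentiableAt (by simp)) (hZ.mdifferentiableAt x),
    mlieBracket_smul_right (hfd x) (hYZ.mdifferentiableAt x),
    mlieBracket_smul_right (hfd x) (hXZ.mdifferentiableAt x)] at jac
  simp only [Pi.add_apply, Pi.smul_apply'] at jac
  rw [jac'] at jac
  rw [← sub_eq_zero]
  refine (smul_eq_zero.mp ?_).resolve_right hv
  linear_combination (norm := module) -jac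

/-! ### Covariant derivatives of tensor fields and the Ricci identities. -/

lemma IsSmoothField.applyField {T : ∀ x : M, TangentSpace I x →L[ℝ] TangentSpace I x}
    {X : Π x : M, TangentSpace I x} (hT : IsSmoothEndomorphismField T) (hX : IsSmoothField X) :
    IsSmoothField (applyField T X) :=
  fun x ↦ ContMDiffAt.clm_bundle_apply (F₁ := E) (F₂ := E) (hT x) (hX x)

lemma mdifferentiableAt_applyField {T : ∀ x : M, TangentSpace I x →L[ℝ] TangentSpace I x}
    {X : Π x : M, TangentSpace I x} {x : M} (hT : IsSmoothEndomorphismField T)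
    (hX : MDiffAt (T% X) x) : MDiffAt (T% (applyField T X)) x :=
  MDifferentiableAt.clm_bundle_apply (F₁ := E) (F₂ := E) ((hT x).mdifferentiableAt (by simp)) hX

lemma IsSmoothOneForm.contMDiff_apply {η : ∀ x : M, TangentSpace I x →L[ℝ] ℝ}
    {X : Π x : M, TangentSpace I x} (hη : IsSmoothOneForm η) (hX : IsSmoothField X) :
    CMDiff ∞ (fun x ↦ η x (X x)) := by
  intro x
  have h := ContMDiffAt.clm_bundle_apply (F₁ := E) (F₂ := ℝ) (hη x) (hX x)
  simp only [contMDiffAt_totalSpace] at h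
  exact h.2

namespace PseudoRiemannianMetric

variable (g : PseudoRiemannianMetric I M)

lemma contMDiff_val {X Y : Π x : M, TangentSpace I x} (hX : IsSmoothField X)
    (hY : IsSmoothField Y) : CMDiff ∞ (fun y ↦ g.val y (X y) (Y y)) :=
  fun x ↦ g.contMDiffAt_val (hX x) (hY x)

variable [CompleteSpace E] [FiniteDimensional ℝ E]

lemma leviCivita_add {Y Y' : Π x : M, TangentSpace I x} {x : M} (hY : MDiffAt (T% Y) x)
    (hY' : MDiffAt (T% Y') x) :
    g.leviCivita (Y + Y') x = g.leviCivita Y x + g.leviCivita Y' x :=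
  g.leviCivita.isCovariantDerivativeOnUniv.add hY hY'

lemma leviCivita_smul {f : M → ℝ} {Y : Π x : M, TangentSpace I x} {x : M} (hf : MDiffAt f x)
    (hY : MDiffAt (T% Y) x) (v : TangentSpace I x) :
    g.leviCivita (f • Y) x v = f x • g.leviCivita Y x v + mvfderiv I f x v • Y x := by
  rw [g.leviCivita.isCovariantDerivativeOnUniv.leibniz hY hf]
  rfl

lemma nabla_add {X Y Y' : Π x : M, TangentSpace I x} (hY : IsSmoothField Y)
    (hY' : IsSmoothField Y') : g.nabla X (Y + Y') = g.nabla X Y + g.nabla X Y' := by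
  ext1 x
  simp [nabla, g.leviCivita_add (hY.mdifferentiableAt x) (hY'.mdifferentiableAt x)]

lemma nabla_smul_apply {f : M → ℝ} {X Y : Π x : M, TangentSpace I x} {x : M} (hf : CMDiff ∞ f)
    (hY : IsSmoothField Y) :
    g.nabla X (f • Y) x = f x • g.nabla X Y x + mvfderiv I f x (X x) • Y x :=
  g.leviCivita_smul ((hf x).mdifferentiableAt (by simp)) (hY.mdifferentiableAt x) _

lemma nabla_const_smul (c : ℝ) {X Y : Π x : M, TangentSpace I x} (hY : IsSmoothField Y) :
    g.nabla X (c • Y) = c • g.nabla X Y := by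
  ext1 x
  have h := g.nabla_smul_apply (f := fun _ ↦ c) (X := X) (x := x) contMDiff_const hY
  rw [mvfderiv_const] at h
  simpa using! h

lemma nabla_sub {X Y Y' : Π x : M, TangentSpace I x} (hY : IsSmoothField Y)
    (hY' : IsSmoothField Y') : g.nabla X (Y - Y') = g.nabla X Y - g.nabla X Y' := by
  have h : IsSmoothField ((-1 : ℝ) • Y') := ContMDiff.const_smul_section hY'
  have e := g.nabla_add (X := X) hY h
  rw [g.nabla_const_smul _ hY'] at e
  simpa [sub_eq_add_neg] using e

lemma nabla_sub_nabla {X Y : Π x : M, TangentSpace I x} (hX : IsSmoothField X)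
    (hY : IsSmoothField Y) : g.nabla X Y - g.nabla Y X = mlieBracket I X Y :=
  funext fun x ↦ g.leviCivita_torsionFree (hX.mdifferentiableAt x) (hY.mdifferentiableAt x)

/-- The covariant derivative of a `(1,1)`-tensor field as a tensor:
`nablaEndomorphismAt T x w v = (∇_v T) w`. -/
def nablaEndomorphismAt {T : ∀ x : M, TangentSpace I x →L[ℝ] TangentSpace I x}
    (hT : IsSmoothEndomorphismField T) (x : M) :
    TangentSpace I x →L[ℝ] TangentSpace I x →L[ℝ] TangentSpace I x :=
  TensorialAt.mkHom (I := I) (F := E)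
    (fun Y ↦ g.leviCivita (applyField T Y) x - (T x).comp (g.leviCivita Y x)) x
    { smul := by
        intro f Y hf hY
        have h : applyField T (f • Y) = f • applyField T Y := by
          ext1 y
          simp [applyField]
        ext1 v
        simp only [sub_apply, ContinuousLinearMap.comp_apply, smul_apply]
        rw [h, g.leviCivita_smul hf (mdifferentiableAt_applyField hT hY), g.leviCivita_smul hf hY]
        simp only [map_add, map_smul, applyField]
        module
      add := by
        intro Y Y' hY hY'
        have h : applyField T (Y + Y') = applyField T Y + applyField T Y' := by
          ext1 y
          simp [applyField]
        ext1 v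
        rw [h, g.leviCivita_add (mdifferentiableAt_applyField hT hY)
          (mdifferentiableAt_applyField hT hY'), g.leviCivita_add hY hY']
        simp only [sub_apply, ContinuousLinearMap.comp_apply, add_apply, map_add]
        module }

lemma nablaEndomorphismAt_apply {T : ∀ x : M, TangentSpace I x →L[ℝ] TangentSpace I x}
    (hT : IsSmoothEndomorphismField T) {X Y : Π x : M, TangentSpace I x} (hY : IsSmoothField Y)
    (x : M) : g.nablaEndomorphismAt hT x (Y x) (X x) = g.nablaEndomorphism T X Y x := by
  rw [nablaEndomorphismAt, TensorialAt.mkHom_apply _ (hY.mdifferentiableAt x)]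
  rfl

lemma nabla_applyField {T : ∀ x : M, TangentSpace I x →L[ℝ] TangentSpace I x}
    (X Y : Π x : M, TangentSpace I x) :
    g.nabla X (applyField T Y) = g.nablaEndomorphism T X Y + applyField T (g.nabla X Y) := by
  simp [nablaEndomorphism]

lemma isSmoothField_nablaEndomorphism {T : ∀ x : M, TangentSpace I x →L[ℝ] TangentSpace I x}
    (hT : IsSmoothEndomorphismField T) {X Y : Π x : M, TangentSpace I x} (hX : IsSmoothField X)
    (hY : IsSmoothField Y) : IsSmoothField (g.nablaEndomorphism T X Y) :=
  (g.isSmoothField_nabla hX (hY.applyField hT)).sub_section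
    ((g.isSmoothField_nabla hX hY).applyField hT)

/-- The second covariant derivative `(∇²_{A,B} T) C` of a `(1,1)`-tensor field. -/
def nablaSqEndomorphism (T : ∀ x : M, TangentSpace I x →L[ℝ] TangentSpace I x)
    (A B C : Π x : M, TangentSpace I x) : Π x : M, TangentSpace I x :=
  g.nabla A (g.nablaEndomorphism T B C) - g.nablaEndomorphism T (g.nabla A B) C
    - g.nablaEndomorphism T B (g.nabla A C)

/-- The second covariant derivative `∇²_{A,B} V` of a vector field. -/
def nablaSq (V A B : Π x : M, TangentSpace I x) : Π x : M, TangentSpace I x :=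
  g.nabla A (g.nabla B V) - g.nabla (g.nabla A B) V

lemma nabla_sub_left (X X' Y : Π x : M, TangentSpace I x) :
    g.nabla (X - X') Y = g.nabla X Y - g.nabla X' Y := by
  ext1 x
  simp [nabla]

/-- The Ricci identity for vector fields. -/
lemma curvature_eq_nablaSq {A B : Π x : M, TangentSpace I x} (hA : IsSmoothField A)
    (hB : IsSmoothField B) (V : Π x : M, TangentSpace I x) :
    g.curvature A B V = g.nablaSq V A B - g.nablaSq V B A := by
  rw [curvature, ← g.nabla_sub_nabla hA hB, nabla_sub_left, nablaSq, nablaSq]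
  abel

/-- The Ricci identity for `(1,1)`-tensor fields. -/
lemma curvatureCommutator_eq_nablaSqEndomorphism
    {T : ∀ x : M, TangentSpace I x →L[ℝ] TangentSpace I x} (hT : IsSmoothEndomorphismField T)
    {A B C : Π x : M, TangentSpace I x} (hA : IsSmoothField A) (hB : IsSmoothField B)
    (hC : IsSmoothField C) :
    g.curvatureCommutator T A B C
      = g.nablaSqEndomorphism T A B C - g.nablaSqEndomorphism T B A C := by
  have hT_sub (Y Y' : Π x : M, TangentSpace I x) :
      applyField T (Y - Y') = applyField T Y - applyField T Y' := by
    ext1 y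
    simp [applyField]
  have hl : g.nablaEndomorphism T (g.nabla A B - g.nabla B A) C
      = g.nablaEndomorphism T (g.nabla A B) C - g.nablaEndomorphism T (g.nabla B A) C := by
    simp only [nablaEndomorphism, nabla_sub_left, hT_sub]
    abel
  rw [curvatureCommutator, curvature, curvature, ← g.nabla_sub_nabla hA hB, g.nabla_applyField B,
    g.nabla_applyField A, g.nabla_applyField (g.nabla A B - g.nabla B A), hl,
    g.nabla_add (g.isSmoothField_nablaEndomorphism hT hB hC)
      ((g.isSmoothField_nabla hB hC).applyField hT),
    g.nabla_add (g.isSmoothField_nablaEndomorphism hT hA hC)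
      ((g.isSmoothField_nabla hA hC).applyField hT),
    g.nabla_applyField, g.nabla_applyField, nablaSqEndomorphism, nablaSqEndomorphism, hT_sub, hT_sub]
  abel

end PseudoRiemannianMetric

/-! ### First-order identities of the structure on M. -/

namespace AlmostParacontactMetricStructure

variable {ε₀ ε₁ : ℝ} (S : AlmostParacontactMetricStructure I M ε₀ ε₁)

lemma ξ_ne_zero (x : M) : S.ξ x ≠ 0 := by
  intro h
  simpa [h] using S.η_ξ x

/-- Since φ²ξ = 0, the formula for φ² at φξ gives φξ = η(φξ)ξ. Applying φ yields η(φξ)φξ = 0, and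
either factor being zero suffices. -/
lemma φ_ξ (hε₁ : ε₁ ≠ 0) (x : M) : S.φ x (S.ξ x) = 0 := by
  have h1 : S.φ x (S.φ x (S.ξ x)) = 0 := by simp [S.φ_sq, S.η_ξ]
  have h2 := S.φ_sq x (S.φ x (S.ξ x))
  rw [h1, map_zero, eq_comm, smul_eq_zero_iff_right hε₁, sub_eq_zero] at h2
  have h3 := congrArg (S.φ x) h2
  rw [h1, map_smul, eq_comm, smul_eq_zero] at h3
  rcases h3 with h3 | h3
  · rw [h2, h3, zero_smul]
  · exact h3

/-- Compare φ(φ²v) with φ²(φv): they differ by a nonzero multiple of η(φv)ξ. -/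
lemma η_φ (hε₁ : ε₁ ≠ 0) (x : M) (v : TangentSpace I x) : S.η x (S.φ x v) = 0 := by
  have h1 := S.φ_sq x (S.φ x v)
  rw [S.φ_sq x v, map_smul, map_sub, map_smul, S.φ_ξ hε₁] at h1
  have h2 : S.φ x v - S.η x v • 0 = S.φ x v - S.η x (S.φ x v) • S.ξ x :=
    smul_right_injective _ hε₁ h1
  rw [smul_zero, sub_zero, eq_comm, sub_eq_self, smul_eq_zero] at h2
  exact h2.resolve_right (S.ξ_ne_zero x)

lemma val_ξ (hε₁ : ε₁ ≠ 0) (x : M) (v : TangentSpace I x) :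
    S.g.val x v (S.ξ x) = ε₀ * S.η x v := by
  have h := S.compatible x v (S.ξ x)
  rw [S.φ_ξ hε₁, map_zero, S.η_ξ, eq_comm, mul_eq_zero, neg_eq_zero] at h
  linarith [h.resolve_left hε₁]

lemma val_φ (hε₁ : ε₁ ≠ 0) (x : M) (v w : TangentSpace I x) :
    S.g.val x (S.φ x v) w = - S.g.val x v (S.φ x w) := by
  have h := S.compatible x v (S.φ x w)
  rw [S.φ_sq, S.η_φ hε₁, map_smul, map_sub, map_smul, S.val_ξ hε₁, S.η_φ hε₁] at h
  simp only [smul_eq_mul, mul_zero, sub_zero] at h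
  refine mul_left_cancel₀ hε₁ ?_
  linarith

lemma phi_apply (X : Π x : M, TangentSpace I x) (x : M) : S.phi X x = S.φ x (X x) :=
  rfl

lemma eta_apply (X : Π x : M, TangentSpace I x) (x : M) : S.eta X x = S.η x (X x) :=
  rfl

lemma metric_apply (X Y : Π x : M, TangentSpace I x) (x : M) :
    S.metric X Y x = S.g.val x (X x) (Y x) :=
  rfl

lemma phi_phi (X : Π x : M, TangentSpace I x) :
    S.phi (S.phi X) = ε₁ • (X - S.eta X • S.ξ) :=
  funext fun x ↦ S.φ_sq x (X x)

lemma isSmoothField_phi {X : Π x : M, TangentSpace I x} (hX : IsSmoothField X) :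
    IsSmoothField (S.phi X) :=
  hX.applyField S.smooth_φ

lemma contMDiff_eta {X : Π x : M, TangentSpace I x} (hX : IsSmoothField X) :
    CMDiff ∞ (S.eta X) :=
  S.smooth_η.contMDiff_apply hX

lemma contMDiff_metric {X Y : Π x : M, TangentSpace I x} (hX : IsSmoothField X)
    (hY : IsSmoothField Y) : CMDiff ∞ (S.metric X Y) :=
  S.g.contMDiff_val hX hY

lemma isSmoothField_smul {f : M → ℝ} {X : Π x : M, TangentSpace I x} (hf : CMDiff ∞ f)
    (hX : IsSmoothField X) : IsSmoothField (f • X) :=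
  hf.smul_section hX

variable [CompleteSpace E]

lemma mvfderiv_extDerivOneForm {X Y : Π x : M, TangentSpace I x}
    (hX : IsSmoothField X) (hY : IsSmoothField Y) (x : M) (v : TangentSpace I x) :
    2 * mvfderiv I (extDerivOneForm S.η X Y) x v =
      mvfderiv I (fun y ↦ mvfderiv I (S.eta Y) y (X y)) x v
      - mvfderiv I (fun y ↦ mvfderiv I (S.eta X) y (Y y)) x v
      - mvfderiv I (S.eta (mlieBracket I X Y)) x v := by
  have h1 : MDiffAt (fun y ↦ mvfderiv I (S.eta Y) y (X y)) x :=
    (contMDiffAt_mvfderiv_apply (S.contMDiff_eta hY x) (hX x)).mdifferentiableAt (by simp)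
  have h2 : MDiffAt (fun y ↦ mvfderiv I (S.eta X) y (Y y)) x :=
    (contMDiffAt_mvfderiv_apply (S.contMDiff_eta hX x) (hY x)).mdifferentiableAt (by simp)
  have h3 : MDiffAt (S.eta (mlieBracket I X Y)) x :=
    (S.contMDiff_eta (isSmoothField_mlieBracket hX hY) x).mdifferentiableAt (by simp)
  have h4 : MDiffAt (fun y ↦ mvfderiv I (S.eta Y) y (X y) - mvfderiv I (S.eta X) y (Y y)) x :=
    h1.sub h2
  have h5 : MDiffAt (fun y ↦ mvfderiv I (S.eta Y) y (X y) - mvfderiv I (S.eta X) y (Y y)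
    - S.eta (mlieBracket I X Y) y) x := h4.sub h3
  change 2 * mvfderiv I (fun y ↦ (1 / 2 : ℝ) * (mvfderiv I (S.eta Y) y (X y)
    - mvfderiv I (S.eta X) y (Y y) - S.eta (mlieBracket I X Y) y)) x v = _
  rw [mvfderiv_fun_mul mdifferentiableAt_const h5, mvfderiv_const, mvfderiv_fun_sub h4 h3,
    mvfderiv_fun_sub h1 h2]
  simp only [smul_zero, add_zero, smul_apply, sub_apply, smul_eq_mul]
  ring

variable [FiniteDimensional ℝ E]

/-- `∇_v ξ`. -/
def nablaξAt (x : M) : TangentSpace I x →L[ℝ] TangentSpace I x :=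
  S.g.leviCivita S.ξ x

/-- `nablaφAt x w v = (∇_v φ) w`. -/
def nablaφAt (x : M) : TangentSpace I x →L[ℝ] TangentSpace I x →L[ℝ] TangentSpace I x :=
  S.g.nablaEndomorphismAt S.smooth_φ x

lemma nabla_ξ_apply (A : Π x : M, TangentSpace I x) (x : M) :
    S.g.nabla A S.ξ x = S.nablaξAt x (A x) :=
  rfl

lemma nablaPhi_apply (A : Π x : M, TangentSpace I x) {B : Π x : M, TangentSpace I x}
    (hB : IsSmoothField B) (x : M) : S.nablaPhi A B x = S.nablaφAt x (B x) (A x) :=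
  (S.g.nablaEndomorphismAt_apply S.smooth_φ hB x).symm

lemma isSmoothField_nablaPhi {X Y : Π x : M, TangentSpace I x} (hX : IsSmoothField X)
    (hY : IsSmoothField Y) : IsSmoothField (S.nablaPhi X Y) :=
  S.g.isSmoothField_nablaEndomorphism S.smooth_φ hX hY

lemma nabla_phi (A B : Π x : M, TangentSpace I x) :
    S.g.nabla A (S.phi B) = S.nablaPhi A B + S.phi (S.g.nabla A B) :=
  S.g.nabla_applyField A B

lemma nabla_phi_apply (A : Π x : M, TangentSpace I x) {B : Π x : M, TangentSpace I x}
    (hB : IsSmoothField B) (x : M) :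
    S.g.nabla A (S.phi B) x = S.nablaφAt x (B x) (A x) + S.φ x (S.g.nabla A B x) := by
  rw [← S.nablaPhi_apply A hB, S.nabla_phi]
  rfl

lemma mvfderiv_metric (A : Π x : M, TangentSpace I x) {B C : Π x : M, TangentSpace I x}
    (hB : IsSmoothField B) (hC : IsSmoothField C) (x : M) :
    mvfderiv I (S.metric B C) x (A x)
      = S.g.val x (S.g.nabla A B x) (C x) + S.g.val x (B x) (S.g.nabla A C x) :=
  S.g.leviCivita_metric (A x) (hB.mdifferentiableAt x) (hC.mdifferentiableAt x)

lemma mvfderiv_eta (hε₀ : ε₀ * ε₀ = 1) (hε₁ : ε₁ ≠ 0) (A : Π x : M, TangentSpace I x)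
    {B : Π x : M, TangentSpace I x} (hB : IsSmoothField B) (x : M) :
    mvfderiv I (S.eta B) x (A x)
      = S.η x (S.g.nabla A B x) + ε₀ * S.g.val x (S.nablaξAt x (A x)) (B x) := by
  have h0 : S.eta B = fun y ↦ ε₀ * S.metric B S.ξ y := by
    ext y
    simp only [metric, S.val_ξ hε₁, eta]
    rw [← mul_assoc, hε₀, one_mul]
  have h1 := (S.contMDiff_metric hB S.smooth_ξ x).mdifferentiableAt (by simp)
  rw [h0, mvfderiv_fun_mul mdifferentiableAt_const h1, mvfderiv_const]
  simp only [smul_zero, add_zero, smul_apply, smul_eq_mul,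
    S.mvfderiv_metric A hB S.smooth_ξ, S.val_ξ hε₁, S.g.symm x (B x), nabla_ξ_apply]
  linear_combination S.η x (S.g.nabla A B x) * hε₀

/-- Differentiating η(ξ) = 1 gives 0 = 2η(∇_v ξ), because η = ε₀ g(·, ξ) and ∇g = 0. -/
lemma η_nablaξAt (hε₀ : ε₀ * ε₀ = 1) (hε₁ : ε₁ ≠ 0) [T2Space M] [SigmaCompactSpace M] (x : M)
    (v : TangentSpace I x) : S.η x (S.nablaξAt x v) = 0 := by
  obtain ⟨V, hV, rfl⟩ := exists_isSmoothField_apply_eq v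
  have h := S.mvfderiv_eta hε₀ hε₁ V S.smooth_ξ x
  have h1 : S.eta S.ξ = fun _ ↦ 1 := funext S.η_ξ
  rw [h1, mvfderiv_const, S.val_ξ hε₁, nabla_ξ_apply] at h
  simp only [zero_apply] at h
  linear_combination -h / 2 - S.η x (S.nablaξAt x (V x)) * hε₀ / 2

lemma extDerivOneForm_eq (hε₀ : ε₀ * ε₀ = 1) (hε₁ : ε₁ ≠ 0) {X Y : Π x : M, TangentSpace I x}
    (hX : IsSmoothField X) (hY : IsSmoothField Y) (x : M) :
    2 * extDerivOneForm S.η X Y x = ε₀ * (S.g.val x (S.nablaξAt x (X x)) (Y x)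
      - S.g.val x (S.nablaξAt x (Y x)) (X x)) := by
  have h1 := S.mvfderiv_eta hε₀ hε₁ X hY x
  have h2 := S.mvfderiv_eta hε₀ hε₁ Y hX x
  have h3 := congrArg (S.η x) (congrFun (S.g.nabla_sub_nabla hX hY) x)
  simp only [Pi.sub_apply, map_sub] at h3
  rw [extDerivOneForm]
  change 2 * (1 / 2 * (mvfderiv I (S.eta Y) x (X x) - mvfderiv I (S.eta X) x (Y x) - _)) = _
  linear_combination h1 - h2 + h3

lemma nablaφAt_skew (hε₁ : ε₁ ≠ 0) [T2Space M] [SigmaCompactSpace M] (x : M)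
    (v w u : TangentSpace I x) :
    S.g.val x (S.nablaφAt x w v) u = - S.g.val x w (S.nablaφAt x u v) := by
  obtain ⟨V, hV, rfl⟩ := exists_isSmoothField_apply_eq v
  obtain ⟨W, hW, rfl⟩ := exists_isSmoothField_apply_eq w
  obtain ⟨U, hU, rfl⟩ := exists_isSmoothField_apply_eq u
  have h0 : S.metric (S.phi W) U = - S.metric W (S.phi U) := funext fun y ↦ S.val_φ hε₁ y _ _
  have h1 := S.mvfderiv_metric V (S.isSmoothField_phi hW) hU x
  have h2 := S.mvfderiv_metric V hW (S.isSmoothField_phi hU) x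
  rw [h0, mvfderiv_neg, neg_apply, h2, S.nabla_phi_apply V hW, S.nabla_phi_apply V hU] at h1
  simp only [map_add, add_apply, phi, applyField, S.val_φ hε₁] at h1
  linarith

/-- The covariant derivative of φ²W = ε₁(W - η(W)ξ). -/
lemma nablaφAt_φ (hε₀ : ε₀ * ε₀ = 1) (hε₁ : ε₁ ≠ 0) [T2Space M] [SigmaCompactSpace M] (x : M)
    (v w : TangentSpace I x) :
    S.nablaφAt x (S.φ x w) v = - S.φ x (S.nablaφAt x w v)
      - (ε₁ * ε₀ * S.g.val x (S.nablaξAt x v) w) • S.ξ x - (ε₁ * S.η x w) • S.nablaξAt x v := by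
  obtain ⟨V, hV, rfl⟩ := exists_isSmoothField_apply_eq v
  obtain ⟨W, hW, rfl⟩ := exists_isSmoothField_apply_eq w
  have h1 := S.nabla_phi_apply V (S.isSmoothField_phi hW) x
  rw [S.phi_phi, S.g.nabla_const_smul _ (hW.sub_section
    (isSmoothField_smul (S.contMDiff_eta hW) S.smooth_ξ)), S.g.nabla_sub hW
    (isSmoothField_smul (S.contMDiff_eta hW) S.smooth_ξ), S.nabla_phi_apply V hW] at h1
  simp only [Pi.smul_apply, Pi.sub_apply, S.g.nabla_smul_apply (S.contMDiff_eta hW) S.smooth_ξ,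
    S.mvfderiv_eta hε₀ hε₁ V hW, nabla_ξ_apply, map_add, S.φ_sq, eta, phi, applyField] at h1
  linear_combination (norm := module) -h1

/-- The exterior derivative of `dη` vanishes. -/
lemma extDerivOneForm_closed [T2Space M] [SigmaCompactSpace M] {X Y Z : Π x : M, TangentSpace I x}
    (hX : IsSmoothField X) (hY : IsSmoothField Y) (hZ : IsSmoothField Z) (x : M) :
    mvfderiv I (extDerivOneForm S.η Y Z) x (X x) + mvfderiv I (extDerivOneForm S.η Z X) x (Y x)
      + mvfderiv I (extDerivOneForm S.η X Y) x (Z x)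
    = extDerivOneForm S.η (mlieBracket I X Y) Z x + extDerivOneForm S.η (mlieBracket I Y Z) X x
      + extDerivOneForm S.η (mlieBracket I Z X) Y x := by
  have : IsManifold I (minSmoothness ℝ 3) M :=
    IsManifold.of_le (n := ∞) (minSmoothness_ofNat_le_infty _)
  have two : minSmoothness ℝ 2 ≤ ∞ := minSmoothness_ofNat_le_infty 2
  have a1 := S.mvfderiv_extDerivOneForm hY hZ x (X x)
  have a2 := S.mvfderiv_extDerivOneForm hZ hX x (Y x)
  have a3 := S.mvfderiv_extDerivOneForm hX hY x (Z x)
  have b1 := mvfderiv_mlieBracket (S.contMDiff_eta hZ) hX hY x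
  have b2 := mvfderiv_mlieBracket (S.contMDiff_eta hX) hY hZ x
  have b3 := mvfderiv_mlieBracket (S.contMDiff_eta hY) hZ hX x
  have jac := congrArg (S.η x) (leibniz_identity_mlieBracket_apply (I := I) ((hX x).of_le two)
    ((hY x).of_le two) ((hZ x).of_le two))
  -- The Jacobi identity is put in the cyclic form matching the brackets in the three terms
  -- dη([·,·],·).
  rw [mlieBracket_swap_apply (V := X) (W := mlieBracket I Y Z),
    mlieBracket_swap_apply (V := Y) (W := mlieBracket I X Z), mlieBracket_swap (V := X) (W := Z),
    ← neg_one_smul ℝ (mlieBracket I Z X), mlieBracket_const_smul_left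
      ((isSmoothField_mlieBracket hZ hX).mdifferentiableAt x), neg_one_smul] at jac
  simp only [map_add, map_neg, neg_neg] at jac
  have e (A B : Π x : M, TangentSpace I x) : 2 * extDerivOneForm S.η A B x =
      mvfderiv I (S.eta B) x (A x) - mvfderiv I (S.eta A) x (B x)
        - S.η x (mlieBracket I A B x) := by
    rw [extDerivOneForm]
    change 2 * (1 / 2 * (mvfderiv I (S.eta B) x (A x) - mvfderiv I (S.eta A) x (B x) - _)) = _
    ring
  have c1 := e (mlieBracket I X Y) Z
  have c2 := e (mlieBracket I Y Z) X
  have c3 := e (mlieBracket I Z X) Y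
  linarith

/-- This is dΦ = d²η = 0. Since ∇ is metric and torsion-free, the derivatives of the fields cancel
against the bracket terms, and only the cyclic sum of ∇φ remains. -/
lemma nablaφAt_cyclic (hε₁ : ε₁ ≠ 0) (hS : S.IsParacontactMetric) [T2Space M]
    [SigmaCompactSpace M] (x : M) (v w u : TangentSpace I x) :
    S.g.val x (S.nablaφAt x w v) u + S.g.val x (S.nablaφAt x u w) v
      + S.g.val x (S.nablaφAt x v u) w = 0 := by
  obtain ⟨X, hX, rfl⟩ := exists_isSmoothField_apply_eq v
  obtain ⟨Y, hY, rfl⟩ := exists_isSmoothField_apply_eq w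
  obtain ⟨Z, hZ, rfl⟩ := exists_isSmoothField_apply_eq u
  have hd {A B : Π x : M, TangentSpace I x} (hA : IsSmoothField A) (hB : IsSmoothField B) :
      extDerivOneForm S.η A B = S.metric A (S.phi B) := funext fun y ↦ (hS A B hA hB y).symm
  have h := S.extDerivOneForm_closed hX hY hZ x
  rw [hd hY hZ, hd hZ hX, hd hX hY, hd (isSmoothField_mlieBracket hX hY) hZ,
    hd (isSmoothField_mlieBracket hY hZ) hX, hd (isSmoothField_mlieBracket hZ hX) hY,
    S.mvfderiv_metric X hY (S.isSmoothField_phi hZ), S.mvfderiv_metric Y hZ (S.isSmoothField_phi hX),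
    S.mvfderiv_metric Z hX (S.isSmoothField_phi hY), S.nabla_phi_apply _ hX,
    S.nabla_phi_apply _ hY, S.nabla_phi_apply _ hZ, ← S.g.nabla_sub_nabla hX hY,
    ← S.g.nabla_sub_nabla hY hZ, ← S.g.nabla_sub_nabla hZ hX] at h
  simp only [metric, phi, applyField, Pi.sub_apply, map_sub, map_add, sub_apply] at h
  have k (a b : TangentSpace I x) : S.g.val x a (S.φ x b) = - S.g.val x b (S.φ x a) := by
    rw [S.g.symm, S.val_φ hε₁]
  rw [k (X x) (S.g.nabla Z Y x), k (Y x) (S.g.nabla X Z x), k (Z x) (S.g.nabla Y X x)] at h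
  rw [S.g.symm x (S.nablaφAt x (Y x) (X x)), S.nablaφAt_skew hε₁ x (Y x) (Z x) (X x),
    S.nablaφAt_skew hε₁ x (Z x) (X x) (Y x)]
  have := S.nablaφAt_skew hε₁ x (X x) (Z x) (Y x)
  have := S.g.symm x (Z x) (S.nablaφAt x (Y x) (X x))
  have := S.g.symm x (Y x) (S.nablaφAt x (Z x) (X x))
  linarith

/-- The values at a point of a (para)contact metric structure and its first covariant
derivatives. -/
def oneJet (hε₀ : ε₀ = 1 ∨ ε₀ = -1) (hε₁ : ε₁ = 1 ∨ ε₁ = -1) (hS : S.IsParacontactMetric)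
    [T2Space M] [SigmaCompactSpace M] (x : M) :
    ParacontactOneJet ε₀ ε₁ (TangentSpace I x) :=
  have h0 : ε₀ * ε₀ = 1 := by rcases hε₀ with rfl | rfl <;> norm_num
  have h1 : ε₁ ≠ 0 := by rcases hε₁ with rfl | rfl <;> norm_num
  { φ := S.φ x
    ξ := S.ξ x
    η := S.η x
    g := LinearMap.mk₂ ℝ (fun v w ↦ S.g.val x v w) (by simp) (by simp) (by simp) (by simp)
    N := S.nablaξAt x
    F := LinearMap.mk₂ ℝ (fun v w ↦ S.nablaφAt x w v) (by simp) (by simp) (by simp) (by simp)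
    ε₀_eq := hε₀
    ε₁_eq := hε₁
    g_symm := S.g.symm x
    nondegenerate := S.g.nondegenerate x
    φ_sq := S.φ_sq x
    η_ξ := S.η_ξ x
    φ_ξ := S.φ_ξ h1 x
    η_φ := S.η_φ h1 x
    g_ξ := S.val_ξ h1 x
    g_φ := S.val_φ h1 x
    η_N := S.η_nablaξAt h0 h1 x
    N_skew := by
      intro v w
      obtain ⟨V, hV, rfl⟩ := exists_isSmoothField_apply_eq v
      obtain ⟨W, hW, rfl⟩ := exists_isSmoothField_apply_eq w
      have h := S.extDerivOneForm_eq h0 h1 hV hW x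
      rw [← hS V W hV hW x] at h
      simp only [LinearMap.mk₂_apply, ContinuousLinearMap.coe_coe]
      linear_combination ε₀ * (-h) - (S.g.val x (S.nablaξAt x (V x)) (W x)
        - S.g.val x (S.nablaξAt x (W x)) (V x)) * h0
    F_skew := S.nablaφAt_skew h1 x
    F_φ := S.nablaφAt_φ h0 h1 x
    F_cyclic := S.nablaφAt_cyclic h1 hS x }

/-! ### Second covariant derivatives of φ and ξ, and the curvature identity. -/

/-- `(∇²_{A,B} φ) C`. -/
def nablaSqPhi (A B C : Π x : M, TangentSpace I x) : Π x : M, TangentSpace I x :=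
  S.g.nablaSqEndomorphism S.φ A B C

/-- `∇²_{A,B} ξ`. -/
def nablaSqξ (A B : Π x : M, TangentSpace I x) : Π x : M, TangentSpace I x :=
  S.g.nablaSq S.ξ A B

lemma nabla_nablaPhi_apply {A B C : Π x : M, TangentSpace I x} (hA : IsSmoothField A)
    (hC : IsSmoothField C) (x : M) :
    S.g.nabla A (S.nablaPhi B C) x = S.nablaSqPhi A B C x
      + S.nablaφAt x (C x) (S.g.nabla A B x) + S.nablaφAt x (S.g.nabla A C x) (B x) := by
  rw [← S.nablaPhi_apply _ hC, ← S.nablaPhi_apply _ (S.g.isSmoothField_nabla hA hC), nablaSqPhi,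
    PseudoRiemannianMetric.nablaSqEndomorphism]
  simp only [Pi.sub_apply, nablaPhi]
  abel

lemma nabla_nabla_ξ_apply (A B : Π x : M, TangentSpace I x) (x : M) :
    S.g.nabla A (S.g.nabla B S.ξ) x = S.nablaSqξ A B x + S.nablaξAt x (S.g.nabla A B x) := by
  rw [← nabla_ξ_apply, nablaSqξ, PseudoRiemannianMetric.nablaSq]
  simp

/-- An instance of the linearity of ∇²_{A,B} φ over functions: the two terms in which A
differentiates η(C) cancel. -/
lemma nablaSqPhi_phi_phi_apply {A B C : Π x : M, TangentSpace I x} (hA : IsSmoothField A)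
    (hB : IsSmoothField B)
    (hC : IsSmoothField C) (x : M) :
    S.nablaSqPhi A B (S.phi (S.phi C)) x
      = ε₁ • (S.nablaSqPhi A B C x - S.η x (C x) • S.nablaSqPhi A B S.ξ x) := by
  have hη := S.contMDiff_eta hC
  have hηξ := isSmoothField_smul hη S.smooth_ξ
  have hD : IsSmoothField (C - S.eta C • S.ξ) := hC.sub_section hηξ
  have hBC := S.isSmoothField_nablaPhi hB hC
  have hBξ := S.isSmoothField_nablaPhi hB S.smooth_ξ
  have hφφ (y : M) : S.phi (S.phi C) y = ε₁ • (C y - S.eta C y • S.ξ y) := S.φ_sq y _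
  have h0 : S.nablaPhi B (S.phi (S.phi C))
      = ε₁ • (S.nablaPhi B C - S.eta C • S.nablaPhi B S.ξ) := by
    ext1 y
    simp only [S.nablaPhi_apply _ (S.isSmoothField_phi (S.isSmoothField_phi hC)),
      Pi.smul_apply, Pi.sub_apply, Pi.smul_apply', S.nablaPhi_apply _ hC,
      S.nablaPhi_apply _ S.smooth_ξ, hφφ, map_smul, map_sub, smul_apply, sub_apply]
  have h1 := S.nabla_nablaPhi_apply (B := B) hA (S.isSmoothField_phi (S.isSmoothField_phi hC)) x
  have h2 : S.g.nabla A (S.phi (S.phi C)) x = ε₁ • (S.g.nabla A C x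
      - (S.eta C x • S.g.nabla A S.ξ x + mvfderiv I (S.eta C) x (A x) • S.ξ x)) := by
    rw [S.phi_phi, S.g.nabla_const_smul _ hD, S.g.nabla_sub hC hηξ]
    simp only [Pi.smul_apply, Pi.sub_apply, S.g.nabla_smul_apply hη S.smooth_ξ]
  rw [h0, S.g.nabla_const_smul _ (hBC.sub_section (isSmoothField_smul hη hBξ)),
    S.g.nabla_sub hBC (isSmoothField_smul hη hBξ), h2, hφφ] at h1
  simp only [Pi.smul_apply, Pi.sub_apply, S.g.nabla_smul_apply hη hBξ,
    S.nabla_nablaPhi_apply hA hC, S.nabla_nablaPhi_apply hA S.smooth_ξ,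
    S.nablaPhi_apply _ S.smooth_ξ, map_smul, map_sub, map_add, smul_apply, sub_apply,
    add_apply] at h1
  rw [← eta_apply]
  linear_combination (norm := module) -h1

section Jet

variable [T2Space M] [SigmaCompactSpace M]

/-- The field identity (∇_B φ)ξ = -φ∇_B ξ differentiated along A. -/
lemma nablaSqPhi_ξ_apply (hε₀ : ε₀ = 1 ∨ ε₀ = -1) (hε₁ : ε₁ = 1 ∨ ε₁ = -1)
    (hS : S.IsParacontactMetric) {A B : Π x : M, TangentSpace I x} (hA : IsSmoothField A)
    (hB : IsSmoothField B) (x : M) :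
    S.nablaSqPhi A B S.ξ x = - S.nablaφAt x (S.nablaξAt x (A x)) (B x)
      - S.nablaφAt x (S.nablaξAt x (B x)) (A x) - S.φ x (S.nablaSqξ A B x) := by
  have hF (y : M) (v : TangentSpace I y) :
      S.nablaφAt y (S.ξ y) v = - S.φ y (S.nablaξAt y v) := (S.oneJet hε₀ hε₁ hS y).F_ξ_right v
  have hBξ := S.g.isSmoothField_nabla hB S.smooth_ξ
  have h0 : S.nablaPhi B S.ξ = (-1 : ℝ) • S.phi (S.g.nabla B S.ξ) := by
    ext1 y
    rw [S.nablaPhi_apply _ S.smooth_ξ, hF, Pi.smul_apply, neg_one_smul]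
    rfl
  have h1 := S.nabla_nablaPhi_apply (B := B) hA S.smooth_ξ x
  rw [h0, S.g.nabla_const_smul _ (S.isSmoothField_phi hBξ), Pi.smul_apply,
    S.nabla_phi_apply A hBξ, nabla_nabla_ξ_apply, hF, nabla_ξ_apply, nabla_ξ_apply, map_add] at h1
  linear_combination (norm := module) -h1

lemma nablaSqξ_phi_apply (hε₀ : ε₀ = 1 ∨ ε₀ = -1) (hε₁ : ε₁ = 1 ∨ ε₁ = -1)
    (hS : S.IsParacontactMetric) (A : Π x : M, TangentSpace I x) {B : Π x : M, TangentSpace I x}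
    (hB : IsSmoothField B) (x : M) :
    S.nablaφAt x (S.nablaξAt x (B x)) (A x) + S.φ x (S.nablaSqξ A B x)
        + S.nablaSqξ A (S.phi B) x + S.nablaξAt x (S.nablaφAt x (B x) (A x))
      = -(2 * ε₀) • (S.nablaφAt x (S.φ x (B x)) (A x) + S.φ x (S.nablaφAt x (B x) (A x))) := by
  -- The term with ε₁(v - η(v)ξ) in `N_φ` is written as φ²v, so that differentiating it produces
  -- only ∇φ and no derivative of η.
  have hN (y : M) (v : TangentSpace I y) :
      S.nablaξAt y (S.φ y v) = - S.φ y (S.nablaξAt y v) - (2 * ε₀) • S.φ y (S.φ y v) := by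
    rw [S.φ_sq, smul_smul]
    exact (S.oneJet hε₀ hε₁ hS y).N_φ v
  have hBξ := S.g.isSmoothField_nabla hB S.smooth_ξ
  have hφB := S.isSmoothField_phi hB
  have h0 : S.g.nabla (S.phi B) S.ξ = (-1 : ℝ) • S.phi (S.g.nabla B S.ξ)
      - (2 * ε₀) • S.phi (S.phi B) := by
    ext1 y
    rw [nabla_ξ_apply, Pi.sub_apply, Pi.smul_apply, Pi.smul_apply, neg_one_smul]
    exact hN y _
  have h1 := S.nabla_nabla_ξ_apply A (S.phi B) x
  rw [h0, S.g.nabla_sub (ContMDiff.const_smul_section (S.isSmoothField_phi hBξ))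
    (ContMDiff.const_smul_section (S.isSmoothField_phi hφB)),
    S.g.nabla_const_smul _ (S.isSmoothField_phi hBξ),
    S.g.nabla_const_smul _ (S.isSmoothField_phi hφB), Pi.sub_apply, Pi.smul_apply, Pi.smul_apply,
    S.nabla_phi_apply A hBξ, nabla_nabla_ξ_apply, S.nabla_phi_apply A hφB, S.nabla_phi_apply A hB,
    nabla_ξ_apply] at h1
  simp only [map_add, hN, phi_apply] at h1 ⊢
  linear_combination (norm := module) -h1

/-- The transfer formula `F_φ_left`, read as an identity of fields and differentiated along A; the
terms containing ∇_A B and ∇_A C cancel by the same formula at the point. -/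
lemma nablaSqPhi_phi_apply (hε₀ : ε₀ = 1 ∨ ε₀ = -1) (hε₁ : ε₁ = 1 ∨ ε₁ = -1)
    (hS : S.IsParacontactMetric) {A B C : Π x : M, TangentSpace I x} (hA : IsSmoothField A)
    (hB : IsSmoothField B) (hC : IsSmoothField C) (x : M) :
    S.nablaSqPhi A (S.phi B) C x + S.nablaφAt x (C x) (S.nablaφAt x (B x) (A x))
      = S.nablaSqPhi A B (S.phi C) x + S.nablaφAt x (S.nablaφAt x (C x) (A x)) (B x)
        - (2 * ε₁ * S.g.val x (S.nablaφAt x (B x) (A x)) (C x)) • S.ξ x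
        - (2 * ε₁ * S.g.val x (S.φ x (B x)) (C x)) • S.nablaξAt x (A x)
        + (ε₁ * ε₀ * S.g.val x (S.nablaξAt x (A x)) (C x)) •
          (S.nablaξAt x (B x) + (2 * ε₀) • S.φ x (B x))
        + (ε₁ * S.η x (C x)) • (S.nablaSqξ A B x + (2 * ε₀) • S.nablaφAt x (B x) (A x)) := by
  have hε₀' : ε₀ * ε₀ = 1 := by rcases hε₀ with rfl | rfl <;> norm_num
  have hε₁' : ε₁ ≠ 0 := by rcases hε₁ with rfl | rfl <;> norm_num
  have hF (y : M) (v w : TangentSpace I y) : S.nablaφAt y w (S.φ y v) = S.nablaφAt y (S.φ y w) v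
      - (2 * ε₁ * S.g.val y (S.φ y v) w) • S.ξ y
      + (ε₁ * S.η y w) • (S.nablaξAt y v + (2 * ε₀) • S.φ y v) :=
    (S.oneJet hε₀ hε₁ hS y).F_φ_left v w
  have hφB := S.isSmoothField_phi hB
  have hφC := S.isSmoothField_phi hC
  have hη := S.contMDiff_eta hC
  have hm := S.contMDiff_metric hφB hC
  have hBξ := S.g.isSmoothField_nabla hB S.smooth_ξ
  have hFBC := S.isSmoothField_nablaPhi hB hφC
  have h2φB : IsSmoothField ((2 * ε₀) • S.phi B) := ContMDiff.const_smul_section hφB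
  have hW : IsSmoothField (S.g.nabla B S.ξ + (2 * ε₀) • S.phi B) := hBξ.add_section h2φB
  have hmξ := isSmoothField_smul hm S.smooth_ξ
  have hmξ' : IsSmoothField ((2 * ε₁) • S.metric (S.phi B) C • S.ξ) :=
    ContMDiff.const_smul_section hmξ
  have hηW := isSmoothField_smul hη hW
  have hηW' : IsSmoothField (ε₁ • S.eta C • (S.g.nabla B S.ξ + (2 * ε₀) • S.phi B)) :=
    ContMDiff.const_smul_section hηW
  have h0 : S.nablaPhi (S.phi B) C = S.nablaPhi B (S.phi C)
      - (2 * ε₁) • S.metric (S.phi B) C • S.ξ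
      + ε₁ • S.eta C • (S.g.nabla B S.ξ + (2 * ε₀) • S.phi B) := by
    ext1 y
    simp only [S.nablaPhi_apply _ hC, S.nablaPhi_apply _ hφC, Pi.add_apply, Pi.sub_apply,
      Pi.smul_apply, Pi.smul_apply', smul_smul (2 * ε₁), smul_smul ε₁]
    exact hF y _ _
  have h1 := S.nabla_nablaPhi_apply (B := S.phi B) hA hC x
  rw [h0, S.g.nabla_add (hFBC.sub_section hmξ') hηW', S.g.nabla_sub hFBC hmξ',
    S.g.nabla_const_smul _ hmξ, S.g.nabla_const_smul _ hηW] at h1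
  simp only [Pi.add_apply, Pi.sub_apply, Pi.smul_apply, S.g.nabla_smul_apply hm S.smooth_ξ,
    S.g.nabla_smul_apply hη hW, S.g.nabla_add hBξ h2φB, S.g.nabla_const_smul _ hφB,
    S.nabla_nabla_ξ_apply, S.nabla_nablaPhi_apply hA hφC, S.nabla_phi_apply A hB,
    S.nabla_phi_apply A hC, S.mvfderiv_metric A hφB hC, S.mvfderiv_eta hε₀' hε₁' A hC,
    nabla_ξ_apply, map_add, add_apply, metric_apply, eta_apply, phi_apply, hF] at h1 ⊢
  linear_combination (norm := module) -h1

/-- The curvature identity of (para)contact metric manifolds. -/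
theorem curvature_identity (hε₀ : ε₀ = 1 ∨ ε₀ = -1) (hε₁ : ε₁ = 1 ∨ ε₁ = -1)
    (hS : S.IsParacontactMetric) {X Y Z : Π x : M, TangentSpace I x} (hX : IsSmoothField X)
    (hY : IsSmoothField Y) (hZ : IsSmoothField Z) (x : M) :
    S.curvComm Z (S.phi X) Y x + S.curvComm (S.phi Z) X Y x
        - ε₁ • S.curvComm (S.phi Z) (S.phi X) (S.phi Y) x - S.curvComm Z X (S.phi Y) x
        - S.eta Y x • (ε₁ • S.curv Z X S.ξ x + S.curv (S.phi Z) (S.phi X) S.ξ x)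
      = -(2 : ℝ) • S.nablaPhi (S.nablaPhi Z X - S.nablaPhi X Z) Y x
        + (2 * ε₀ * ε₁ * S.eta X x) • S.nablaPhi Z Y x
        - (2 * ε₀ * ε₁ * S.eta Z x) • S.nablaPhi X Y x
        - (2 * ε₁ * S.metric Y (S.nablaPhi Z X - S.nablaPhi X Z) x) • S.ξ x
        + (2 * ε₀ * ε₁ * S.eta Y x) • (S.nablaPhi Z X x - S.nablaPhi X Z x)
        - (4 * ε₀ * S.metric (S.phi X) (S.phi Y) x) • S.phi (S.phi Z) x
        + (4 * ε₀ * S.metric (S.phi Z) (S.phi Y) x) • S.phi (S.phi X) x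
        + (4 * ε₀ * ε₁ * S.metric Y (S.phi X) x) • S.phi Z x
        - (4 * ε₀ * ε₁ * S.metric Y (S.phi Z) x) • S.phi X x := by
  have hε₀' : ε₀ * ε₀ = 1 := by rcases hε₀ with rfl | rfl <;> norm_num
  have hε₁' : ε₁ ≠ 0 := by rcases hε₁ with rfl | rfl <;> norm_num
  have hφX := S.isSmoothField_phi hX
  have hφY := S.isSmoothField_phi hY
  have hφZ := S.isSmoothField_phi hZ
  have ricci {A B C : Π x : M, TangentSpace I x} (hA : IsSmoothField A) (hB : IsSmoothField B)
      (hC : IsSmoothField C) :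
      S.curvComm A B C x = S.nablaSqPhi A B C x - S.nablaSqPhi B A C x :=
    congrFun (S.g.curvatureCommutator_eq_nablaSqEndomorphism S.smooth_φ hA hB hC) x
  have ricciξ {A B : Π x : M, TangentSpace I x} (hA : IsSmoothField A) (hB : IsSmoothField B) :
      S.curv A B S.ξ x = S.nablaSqξ A B x - S.nablaSqξ B A x :=
    congrFun (S.g.curvature_eq_nablaSq hA hB S.ξ) x
  rw [ricci hZ hφX hY, ricci hφZ hX hY, ricci hφZ hφX hφY, ricci hZ hX hφY, ricciξ hZ hX,
    ricciξ hφZ hφX, S.nablaPhi_apply _ hY, S.nablaPhi_apply _ hY, S.nablaPhi_apply _ hY,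
    metric_apply, Pi.sub_apply, S.nablaPhi_apply _ hX, S.nablaPhi_apply _ hZ]
  exact (S.oneJet hε₀ hε₁ hS x).curvature_identity_of_second_order (X x) (Y x) (Z x)
    _ _ _ _ _ _ _ _ _ _ _ _ _ _ _ _ _ _
    (S.nablaSqPhi_phi_apply hε₀ hε₁ hS hZ hX hY x)
    (S.nablaSqPhi_phi_apply hε₀ hε₁ hS hX hZ hY x)
    (S.nablaSqPhi_phi_apply hε₀ hε₁ hS hφZ hX hφY x)
    (S.nablaSqPhi_phi_apply hε₀ hε₁ hS hφX hZ hφY x)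
    (S.nablaSqPhi_phi_phi_apply hφZ hX hY x)
    (S.nablaSqPhi_phi_phi_apply hφX hZ hY x)
    (S.nablaSqPhi_ξ_apply hε₀ hε₁ hS hφZ hX x)
    (S.nablaSqPhi_ξ_apply hε₀ hε₁ hS hφX hZ x)
    (S.nablaSqξ_phi_apply hε₀ hε₁ hS (S.phi Z) hX x)
    (S.nablaSqξ_phi_apply hε₀ hε₁ hS (S.phi X) hZ x)

end Jet

end AlmostParacontactMetricStructure

end ParacontactGeometry

end

theorem mainTheorem3 (n : ℕ) (M : Type*) [TopologicalSpace M]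
    [ChartedSpace (EuclideanSpace ℝ (Fin (2 * n + 1))) M] [IsManifold (𝓡 (2 * n + 1)) ∞ M]
    [T2Space M] [SecondCountableTopology M]
    (ε₀ ε₁ : ℝ) (hε₀ : ε₀ = 1 ∨ ε₀ = -1) (hε₁ : ε₁ = 1 ∨ ε₁ = -1)
    (S : AlmostParacontactMetricStructure (𝓡 (2 * n + 1)) M ε₀ ε₁) (hS : S.IsParacontactMetric)
    (X Y Z : Π x : M, TangentSpace (𝓡 (2 * n + 1)) x)
    (hX : IsSmoothField X) (hY : IsSmoothField Y) (hZ : IsSmoothField Z) (x : M) :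
    S.curvComm Z (S.phi X) Y x + S.curvComm (S.phi Z) X Y x
        - ε₁ • S.curvComm (S.phi Z) (S.phi X) (S.phi Y) x - S.curvComm Z X (S.phi Y) x
        - S.eta Y x • (ε₁ • S.curv Z X S.ξ x + S.curv (S.phi Z) (S.phi X) S.ξ x)
      = -(2 : ℝ) • S.nablaPhi (S.nablaPhi Z X - S.nablaPhi X Z) Y x
        + (2 * ε₀ * ε₁ * S.eta X x) • S.nablaPhi Z Y x
        - (2 * ε₀ * ε₁ * S.eta Z x) • S.nablaPhi X Y x
        - (2 * ε₁ * S.metric Y (S.nablaPhi Z X - S.nablaPhi X Z) x) • S.ξ x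
        + (2 * ε₀ * ε₁ * S.eta Y x) • (S.nablaPhi Z X x - S.nablaPhi X Z x)
        - (4 * ε₀ * S.metric (S.phi X) (S.phi Y) x) • S.phi (S.phi Z) x
        + (4 * ε₀ * S.metric (S.phi Z) (S.phi Y) x) • S.phi (S.phi X) x
        + (4 * ε₀ * ε₁ * S.metric Y (S.phi X) x) • S.phi Z x
        - (4 * ε₀ * ε₁ * S.metric Y (S.phi Z) x) • S.phi X x := by
  -- With second countability this gives the σ-compactness required for partitions of unity.
  have : LocallyCompactSpace M :=
    ChartedSpace.locallyCompactSpace (EuclideanSpace ℝ (Fin (2 * n + 1))) M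
  exact S.curvature_identity hε₀ hε₁ hS hX hY hZ x
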